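/- **Setting.** Let $K$ be a field of characteristic $0$, $s\in K$, $a_{k,l}\in K$ for $k\ge 1$, $l\ge 0$, and let $D\subseteq\{1,2,3,\dots\}$ be a set of decorations (for instance $D=\{1,\dots,N\}$ or $D=\{1,2,\dots\}$). For $r\in K$ write $\binom{r}{n}=r(r-1)\cdots(r-n+1)/n!$. A *rooted chord diagram* of size $n$ is a fixed point free involution of $\{1,\dots,2n\}$; its 2-cycles $(x\,y)$, $x<y$, are the chords, and the chord containing $1$ is the root chord. Chords $(x\,y)$, $(x'\,y')$ cross if $x<x'<y<y'$ or $x'<x<y'<y$. The diagram is *connected* if its intersection graph (vertices are chords, edges are crossings) is connected and nonempty. Every chord $c$ of $C$ carries a decoration in $D$, and $\|C\|$ is the sum of the decorations. $\mathcal R^{dec}$ is the set of decorated rooted connected chord diagrams. *Intersection order.* Chords are labelled $1,2,\dots$ as follows: the root chord comes first; then the connected components of the diagram without its root chord, ordered by their first endpoint, are labelled one after the other, each by the same procedure. $d_c$ is the decoration of the chord with label $c$. A chord is *terminal* if it crosses no chord with larger first endpoint. Let $t_0<t_1<\dots<t_m$ be the labels of the terminal chords, $b(C)=t_0$ (the base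 chord), and $$\hat a_C=\prod_{j=1}^{m}a_{d_{t_j},\,t_j-t_{j-1}}\prod_{c\text{ not terminal}}a_{d_c,0}.$$ *Insertion tree.* If $C$ has more than one chord, let $C''$ be the first connected component of $C$ without its root chord, and $C'$ the rest of $C$ (including the root chord). All endpoints of $C'$ other than the first one lie in one interval between consecutive endpoints of $C''$; let it be the $k$-th. The binary rooted plane tree $T(C)$ is one leaf if $C$ has one chord, and otherwise $T(C)=T(C')\circ_kT(C'')$: number the edges of $T(C'')$ in pre-order, starting with $1$ for a virtual edge above the root; put a new vertex on edge $k$, with $T(C')$ as left subtree and the part of $T(C'')$ below edge $k$ as right subtree. Leaves correspond to chords of $C$. Let $\nu_c$ be the number of edges of the path that starts at the leaf of chord $c$ and goes up and to the left as long as possible (so $\nu_c=0$ if the leaf is a left child or the root). The weight of $C$ is $$\omega_C=\prod_{c}\binom{s\,d_c+\nu_c-2}{\nu_c}.$$ For $k\ge 1$ define the formal power series $$g^{comb}_k(x)=\sum_{C\in\mathcal R^{dec},\ b(C)\ge k}x^{\|C\|}\,\omega_C\,\hat a_C\,a_{d_{b(C)},\,b(C)-k},$$ the formal differential operator $G^{comb}_{\partial\rho}=\sum_{l\ge1}\frac{g^{comb}_l(x)}{l!}\,\partial_\rho^l$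 (a power series in $\partial_\rho$ with coefficients in $K[[x]]$), and $\tilde F_k(\rho)=\sum_{l\ge0}a_{k,l}\rho^l$. **Lemma.** $g^{comb}_1$ satisfies $$g_1^{comb}(x)=\sum_{k\in D}x^k\sum_{n\ge0}\binom{n+sk-2}{n}\,\Bigl[(G^{comb}_{\partial\rho})^n\tilde F_k(\rho)\Bigr]_{\rho=0}$$ in $K[[x]]$, where all infinite sums (including the one over the powers of $\partial_\rho$ hidden in $[(G^{comb}_{\partial\rho})^n\tilde F_k(\rho)]_{\rho=0}$) converge as formal power series: each coefficient of $x^i$ receives only finitely many nonzero contributions. -/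

import Mathlib

section ChordSets

/-- A chord on the integer positions, written `(x, y)` with `x < y`. -/
abbrev Chord := ℕ × ℕ

/-- Two chords `(x, y)`, `(x', y')` cross if `x < x' < y < y'` or `x' < x < y' < y`. -/
def Chord.Crosses (c e : Chord) : Prop :=
  (c.1 < e.1 ∧ e.1 < c.2 ∧ c.2 < e.2) ∨ (e.1 < c.1 ∧ c.1 < e.2 ∧ e.2 < c.2)

theorem Chord.Crosses.symm {c e : Chord} (h : c.Crosses e) : e.Crosses c := Or.symm h

/-- The intersection graph of a set of chords. -/
def intersectionGraph (S : Finset Chord) : SimpleGraph S where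
  Adj c e := Chord.Crosses c e
  symm := ⟨fun _ _ h => h.symm⟩
  loopless := ⟨fun _ h => by rcases h with h | h <;> exact lt_irrefl _ h.1⟩

/-- The root chord: the chord with the smallest endpoint. -/
noncomputable def rootChord (S : Finset Chord) : Chord :=
  if h : S.Nonempty then (S.exists_min_image Prod.fst h).choose else (0, 0)

theorem rootChord_mem {S : Finset Chord} (h : S.Nonempty) : rootChord S ∈ S := by
  rw [rootChord, dif_pos h]
  exact (S.exists_min_image Prod.fst h).choose_spec.1

open scoped Classical in
/-- The connected component of `S` (for crossing of chords) that contains its root chord. -/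
noncomputable def rootComponent (S : Finset Chord) : Finset Chord :=
  S.filter fun c => ∃ (hr : rootChord S ∈ S) (hc : c ∈ S),
    (intersectionGraph S).Reachable ⟨rootChord S, hr⟩ ⟨c, hc⟩

open scoped Classical in
theorem rootComponent_subset (S : Finset Chord) : rootComponent S ⊆ S :=
  Finset.filter_subset _ _

open scoped Classical in
theorem rootChord_mem_rootComponent {S : Finset Chord} (h : S.Nonempty) :
    rootChord S ∈ rootComponent S :=
  Finset.mem_filter.2 ⟨rootChord_mem h, rootChord_mem h, rootChord_mem h, .refl _⟩

/-- The list of the chords of `S` in intersection order: the connected components of `S` are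
traversed counterclockwise (that is, by their first endpoint); in each component the root chord
comes first, followed by the intersection order of what is left of the component after
the removal of its root chord. -/
noncomputable def intersectionOrder (S : Finset Chord) : List Chord :=
  if h : S.Nonempty then
    rootChord S ::
      (intersectionOrder ((rootComponent S).erase (rootChord S)) ++
        intersectionOrder (S \ rootComponent S))
  else []
termination_by S.card
decreasing_by
  · exact (Finset.card_erase_lt_of_mem (rootChord_mem_rootComponent h)).trans_le
      (Finset.card_le_card (rootComponent_subset S))
  · exact Finset.card_lt_card (Finset.sdiff_ssubset (rootComponent_subset S)
      ⟨_, rootChord_mem_rootComponent h⟩)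

/-- The label `1, 2, …` of a chord of `S` in the intersection order. -/
noncomputable def chordLabel (S : Finset Chord) (c : Chord) : ℕ :=
  (intersectionOrder S).idxOf c + 1

open scoped Classical in
/-- The terminal chords: those that cross no chord with a larger first endpoint. -/
noncomputable def terminalChords (S : Finset Chord) : Finset Chord :=
  S.filter fun c => ∀ e ∈ S, c.1 < e.1 → ¬ c.Crosses e

open scoped Classical in
theorem terminalChords_nonempty {S : Finset Chord} (h : S.Nonempty) :
    (terminalChords S).Nonempty := by
  obtain ⟨c, hc, hmax⟩ := S.exists_max_image Prod.fst h
  exact ⟨c, Finset.mem_filter.2 ⟨hc, fun e he hlt => absurd (hmax e he) (not_le.2 hlt)⟩⟩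

/-- The base chord: the terminal chord with the smallest label. -/
noncomputable def baseChord (S : Finset Chord) : Chord :=
  if h : S.Nonempty then
    ((terminalChords S).exists_min_image (chordLabel S) (terminalChords_nonempty h)).choose
  else (0, 0)

open scoped Classical in
theorem baseChord_mem {S : Finset Chord} (h : S.Nonempty) : baseChord S ∈ S := by
  rw [baseChord, dif_pos h]
  exact Finset.filter_subset _ _
    ((terminalChords S).exists_min_image (chordLabel S) (terminalChords_nonempty h)).choose_spec.1

/-- The largest label of a terminal chord that is smaller than the label of `c`: if `c` has label
`t_j` with `j ≥ 1`, where `t_0 < t_1 < …` are the labels of the terminal chords, it is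
`t_{j-1}`. -/
noncomputable def prevTerminalLabel (S : Finset Chord) (c : Chord) : ℕ :=
  (((terminalChords S).image (chordLabel S)).filter (· < chordLabel S c)).sup id

/-- Rooted plane binary trees whose leaves carry chords. -/
inductive InsTree : Type
  | leaf (c : Chord) : InsTree
  | node (l r : InsTree) : InsTree

/-- The number of vertices of a tree; also the number of its edges, the virtual edge above the
root included. -/
def InsTree.numVertices : InsTree → ℕ
  | .leaf _ => 1
  | .node l r => 1 + l.numVertices + r.numVertices

/-- The insertion `T ∘ₖ T'`, written `T.insertAt T' k`, where the edges of `T'` are numbered from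
`1` in pre-order and edge `1` is the virtual edge above the root: a new vertex in the middle of edge
`k`, with `T` as its left subtree and the part of `T'` below edge `k` as its right subtree. -/
def InsTree.insertAt (T : InsTree) : InsTree → ℕ → InsTree
  | .leaf c, _ => .node T (.leaf c)
  | .node l r, k =>
      if k ≤ 1 then .node T (.node l r)
      else if k ≤ 1 + l.numVertices then .node (T.insertAt l (k - 1)) r
      else .node l (T.insertAt r (k - 1 - l.numVertices))

/-- For the leaf that carries `c`: the number of edges of the path that starts at this leaf and goes
up to the left as long as it can. The second argument counts the edges of this path that lie above
the root of the tree. -/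
def InsTree.branchLeft (c : Chord) : InsTree → ℕ → ℕ
  | .leaf e, j => if e = c then j else 0
  | .node l r, j => l.branchLeft c 0 + r.branchLeft c (j + 1)

/-- The first connected component of `S` with its root chord removed. -/
noncomputable def firstComponent (S : Finset Chord) : Finset Chord :=
  rootComponent (S.erase (rootChord S))

theorem rootChord_mem_sdiff_firstComponent {S : Finset Chord} (h : S.Nonempty) :
    rootChord S ∈ S \ firstComponent S := by
  refine Finset.mem_sdiff.2 ⟨rootChord_mem h, fun hm => ?_⟩
  exact Finset.notMem_erase _ _ (rootComponent_subset _ hm)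

theorem firstComponent_ssubset {S : Finset Chord} (h : S.Nonempty) : firstComponent S ⊂ S :=
  (rootComponent_subset _).trans_ssubset (Finset.erase_ssubset (rootChord_mem h))

theorem firstComponent_nonempty {S : Finset Chord} (h : S.Nontrivial) :
    (firstComponent S).Nonempty :=
  ⟨_, rootChord_mem_rootComponent (h.erase_nonempty)⟩

/-- The index `k` of the root share decomposition `S = S' ∘ₖ S''` of a connected diagram, where
`S''` is the first component after removal of the root chord `(x, y)` and `S'` is the rest: all the
endpoints of `S'` other than `x` lie in the same interval between consecutive endpoints of `S''`,
the `k`-th one, where `k` is the number of endpoints of `S''` that lie before `y`. -/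
noncomputable def insertionIndex (S : Finset Chord) : ℕ :=
  (((firstComponent S).image Prod.fst ∪ (firstComponent S).image Prod.snd).filter
    (· < (rootChord S).2)).card

/-- The binary insertion tree of a connected diagram: `T(S) = T(S') ∘ₖ T(S'')` along the root share
decomposition `S = S' ∘ₖ S''`, and a single leaf if there is only one chord. Leaves carry the chords
of the original diagram, so that the labels are the induced ones. -/
noncomputable def insertionTree (S : Finset Chord) : InsTree :=
  if h : S.Nontrivial then
    (insertionTree (S \ firstComponent S)).insertAt (insertionTree (firstComponent S))
      (insertionIndex S)
  else .leaf (rootChord S)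
termination_by S.card
decreasing_by
  · exact Finset.card_lt_card (Finset.sdiff_ssubset (firstComponent_ssubset h.nonempty).subset
      (firstComponent_nonempty h))
  · exact Finset.card_lt_card (firstComponent_ssubset h.nonempty)

/-- The entry `ν_c` of the branch-left vector. -/
noncomputable def branchLeft (S : Finset Chord) (c : Chord) : ℕ :=
  (insertionTree S).branchLeft c 0

end ChordSets

/-- The set of chords `(i, σ i)`, `i < σ i`, of an involution of the `2n` positions. -/
def chordsOf {n : ℕ} (σ : Equiv.Perm (Fin (2 * n))) : Finset Chord :=
  (Finset.univ.filter fun i : Fin (2 * n) => i < σ i).image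
    fun i : Fin (2 * n) => ((i : ℕ), (σ i : ℕ))

/-- A rooted connected chord diagram with `size` chords: a fixed point free involution of the `2n`
positions with connected (in particular nonempty) intersection graph, whose chords are decorated by
elements of the set `D` of positive integers. -/
structure DecChordDiagram (D : Set ℕ+) where
  size : ℕ
  perm : Equiv.Perm (Fin (2 * size))
  involutive : ∀ i, perm (perm i) = i
  fixedPointFree : ∀ i, perm i ≠ i
  connected : (intersectionGraph (chordsOf perm)).Connected
  dec : chordsOf perm → ℕ+
  dec_mem : ∀ c, dec c ∈ D

namespace DecChordDiagram

variable {D : Set ℕ+}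

/-- The underlying set of chords. -/
def chords (C : DecChordDiagram D) : Finset Chord := chordsOf C.perm

theorem chords_nonempty (C : DecChordDiagram D) : C.chords.Nonempty := by
  obtain ⟨c⟩ := C.connected.nonempty
  exact ⟨c.1, c.2⟩

/-- `‖C‖`, the sum of the decorations of all chords. -/
def norm (C : DecChordDiagram D) : ℕ := ∑ c, (C.dec c : ℕ)

/-- The base chord, as an element of the set of chords. -/
noncomputable def base (C : DecChordDiagram D) : chordsOf C.perm :=
  ⟨baseChord C.chords, baseChord_mem C.chords_nonempty⟩

/-- `b(C)`, the label of the base chord. -/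
noncomputable def b (C : DecChordDiagram D) : ℕ := chordLabel C.chords C.base

variable {K : Type*} [Field K] [CharZero K]

/-- The weight `ω_C = ∏_c binom(s d_c + ν_c - 2, ν_c)`. -/
noncomputable def weight (s : K) (C : DecChordDiagram D) : K :=
  ∏ c, Ring.choose (s * ((C.dec c : ℕ) : K) + (branchLeft C.chords c : K) - 2)
    (branchLeft C.chords c)

open scoped Classical in
/-- The monomial `â_C`: a factor `a_{d, t_j - t_{j-1}}` for every terminal chord (with decoration
`d` and label `t_j`) other than the base chord, and a factor `a_{d, 0}` for every chord (with
decoration `d`) that is not terminal. -/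
noncomputable def monomialHat (a : ℕ → ℕ → K) (C : DecChordDiagram D) : K :=
  (∏ c with c.1 ∈ terminalChords C.chords ∧ c ≠ C.base,
      a (C.dec c) (chordLabel C.chords c - prevTerminalLabel C.chords c)) *
    ∏ c with c.1 ∉ terminalChords C.chords, a (C.dec c) 0

theorem size_le_norm (C : DecChordDiagram D) : C.size ≤ C.norm := by
  have hcard : 2 * C.size ≤ 2 * (chordsOf C.perm).card := by
    have h1 : (chordsOf C.perm).card = (Finset.univ.filter fun i : Fin (2 * C.size) => i < C.perm i).card := by
      refine Finset.card_image_of_injective _ fun (i j : Fin (2 * C.size)) hij => ?_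
      exact Fin.ext (Prod.ext_iff.1 hij).1
    have h2 : (Finset.univ.filter fun i : Fin (2 * C.size) => ¬ i < C.perm i).card ≤
        (Finset.univ.filter fun i : Fin (2 * C.size) => i < C.perm i).card := by
      refine Finset.card_le_card_of_injOn C.perm (fun i hi => ?_) C.perm.injective.injOn
      simp only [Finset.coe_filter, Finset.mem_univ, true_and, Set.mem_ofPred_eq] at hi ⊢
      rw [C.involutive]
      exact lt_of_le_of_ne (not_lt.1 hi) (C.fixedPointFree i)
    have h3 := Finset.card_filter_add_card_filter_not (s := (Finset.univ : Finset (Fin (2 * C.size))))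
      (fun i => i < C.perm i)
    rw [Finset.card_univ, Fintype.card_fin] at h3
    omega
  have hsum : (chordsOf C.perm).card ≤ C.norm := by
    have h := Finset.card_nsmul_le_sum (Finset.univ : Finset (chordsOf C.perm))
      (fun c => (C.dec c : ℕ)) 1 (fun c _ => (C.dec c).pos)
    simpa [norm] using h
  omega

/-- There are finitely many decorated diagrams with a given sum of decorations, so that the sums in
the definition of `gComb` are finite. -/
theorem finite_norm_eq (D : Set ℕ+) (i : ℕ) : {C : DecChordDiagram D | C.norm = i}.Finite := by
  let X := (n : Fin (i + 1)) × (σ : Equiv.Perm (Fin (2 * n))) × (chordsOf σ → Fin (i + 1))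
  let f : {C : DecChordDiagram D | C.norm = i} → X := fun C =>
    ⟨⟨C.1.size, Nat.lt_succ_of_le (C.1.size_le_norm.trans (le_of_eq C.2))⟩, C.1.perm, fun c =>
      ⟨C.1.dec c, Nat.lt_succ_of_le ((Finset.single_le_sum (f := fun c => (C.1.dec c : ℕ))
        (fun _ _ => Nat.zero_le _) (Finset.mem_univ c)).trans (le_of_eq C.2))⟩⟩
  have hf : Function.Injective f := by
    rintro ⟨⟨n, σ, _, _, _, d, _⟩, hC⟩ ⟨⟨m, τ, _, _, _, e, _⟩, hE⟩ h
    simp only [f, X, Sigma.mk.injEq, Fin.mk.injEq] at h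
    obtain ⟨rfl, h⟩ := h
    simp only [heq_eq_eq, Sigma.mk.injEq] at h
    obtain ⟨rfl, h⟩ := h
    have hde : d = e := by
      funext c
      have := congrFun (eq_of_heq h) c
      simpa using this
    subst hde
    rfl
  exact Set.finite_coe_iff.1 (Finite.of_injective f hf)

end DecChordDiagram

section Series

variable {K : Type*} [Field K] [CharZero K]

/-- The series `g_k^comb(x) = ∑_{b(C) ≥ k} x^‖C‖ ω_C â_C a_{d_{b(C)}, b(C) - k}`, where `C` runs
over the rooted connected chord diagrams decorated by `D`. -/
noncomputable def gComb (D : Set ℕ+) (s : K) (a : ℕ → ℕ → K) (k : ℕ) : PowerSeries K :=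
  PowerSeries.mk fun i => ∑ᶠ C ∈ {C : DecChordDiagram D | C.norm = i ∧ k ≤ C.b},
    C.weight s * C.monomialHat a * a (C.dec C.base) (C.b - k)

/-- The operator `G_∂ρ^comb = ∑_{l ≥ 1} (g_l^comb(x) / l!) ∂_ρ^l`, as a power series in the symbol
`∂_ρ` whose coefficients are power series in `x`. -/
noncomputable def gOperator (D : Set ℕ+) (s : K) (a : ℕ → ℕ → K) :
    PowerSeries (PowerSeries K) :=
  PowerSeries.mk fun l =>
    if l = 0 then 0 else PowerSeries.C ((l.factorial : K)⁻¹) * gComb D s a l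

/-- The series `F̃_k(ρ) = ∑_{l ≥ 0} a_{k,l} ρ^l`. -/
noncomputable def fTilde (a : ℕ → ℕ → K) (k : ℕ) : PowerSeries K :=
  PowerSeries.mk (a k)

/-- The value `(∂_ρ^m F)(0)`. -/
noncomputable def derivAtZero (m : ℕ) (F : PowerSeries K) : K :=
  PowerSeries.constantCoeff ((PowerSeries.derivative K)^[m] F)

/-- `f` is summable as a family of formal power series, with sum `S`: every coefficient is nonzero
for only finitely many members of the family, and their sum is the coefficient of `S`. -/
def HasFormalSum {ι : Type*} (f : ι → PowerSeries K) (S : PowerSeries K) : Prop :=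
  ∀ i : ℕ, (Function.support fun j => PowerSeries.coeff i (f j)).Finite ∧
    ∑ᶠ j, PowerSeries.coeff i (f j) = PowerSeries.coeff i S

/-- `Φ`, an operator given as a power series in `∂_ρ` over `K⟦x⟧`, can be applied to `F(ρ)` at
`ρ = 0`, with value `∑_m (coefficient of ∂_ρ^m in Φ) (∂_ρ^m F)(0) = S(x)`. -/
def HasOperatorValue (Φ : PowerSeries (PowerSeries K)) (F : PowerSeries K) (S : PowerSeries K) :
    Prop :=
  HasFormalSum (fun m : ℕ => PowerSeries.coeff m Φ * PowerSeries.C (derivAtZero m F)) S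

end Series

/-! Cut the insertion tree of a diagram $C$ with at least two chords at its root: the left subtree
is the tree of a diagram $E$, the right subtree that of a diagram $C'$ with the same base chord as
$C$. Of the $b(C)-1$ chords of $C$ that precede the base chord, some number $l\ge1$ belongs to $E$,
where $l\le b(E)$, and the other $b(C')-1$ to $C'$. Conversely, $(E,l,C')$ comes from exactly
$\binom{b(C)-1}{l}$ diagrams, one for each choice of the positions of those $l$ chords. Moreover
$\hat a_C=\hat a_E\,a_{d_{b(E)},b(E)-l}\,\hat a_{C'}$, so $E$ contributes precisely a summand of
$g_l^{comb}$, while one more edge appears above the root of the tree of $C'$.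

Fix the decoration $d$ of the base chord and let $P_j$ be the exponential generating series, in
$\partial_\rho^m/m!$, of the diagrams with $b(C)=m+1$, without the factor $a$ of the base chord and
with $j$ extra edges above the root of the tree. The binomial count becomes the product formula
$P_j=x^d w_{d,j}+G^{comb}_{\partial\rho}P_{j+1}$ with $w_{d,\nu}=\binom{sd+\nu-2}{\nu}$
(`baseSum_splitValue`, `partialSeries_eq`). Since $G^{comb}_{\partial\rho}$ has no constant term in
$\partial_\rho$, iteration gives $P_0=x^d\sum_n w_{d,n}(G^{comb}_{\partial\rho})^n$. Applying this
to $\tilde F_d$ at $\rho=0$ replaces $\partial_\rho^m/m!$ by $a_{d,m}$, the missing factor of the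
base chord; summation over $d$ gives $g_1^{comb}$ (`hasFormalSum_powerValue`). The sums are finite
in each degree because $b(C)\le\|C\|$ makes the coefficient of $\partial_\rho^m$ in every power
divisible by $x^m$.

All this is done on codes, formal terms that record iterated root share decompositions. The rest of
the proof shows that decorated diagrams are in bijection with valid codes and that the bijection
respects size, norm, base chord, weight and monomial: `IsRootShare` describes how these data behave
under one decomposition, `exists_codeOf_eq` glues diagrams together, and `eq_of_codeOf_eq` recovers
a diagram from its code. -/

/-! ### Codes of diagrams and their splitting at the root of the insertion tree. -/

/-- Iterated root share decompositions of decorated rooted connected chord diagrams: a single chord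
with decoration `d`, or the diagram with root share decomposition `A ∘ₖ B`. -/
inductive ChordCode : Type
  | single (d : ℕ+) : ChordCode
  | ins (A B : ChordCode) (k : ℕ) : ChordCode

/-- The product, over the leaves of the tree, of `w d ν`, where `d` is the first entry of the leaf
and `ν` the length of the path going up to the left, `j` edges of which lie above the root. -/
def InsTree.weight {R : Type*} [CommMonoid R] (w : ℕ → ℕ → R) : InsTree → ℕ → R
  | .leaf c, j => w c.1 j
  | .node l r, j => l.weight w 0 * r.weight w (j + 1)

namespace ChordCode

/-- The number of chords. -/
def size : ChordCode → ℕ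
  | single _ => 1
  | ins A B _ => A.size + B.size

/-- The sum of the decorations. -/
def norm : ChordCode → ℕ
  | single d => d
  | ins A B _ => A.norm + B.norm

/-- The label of the base chord. -/
def baseIndex : ChordCode → ℕ
  | single _ => 1
  | ins _ B _ => B.baseIndex + 1

/-- The decoration of the base chord. -/
def baseDec : ChordCode → ℕ+
  | single d => d
  | ins _ B _ => B.baseDec

/-- All decorations lie in `D` and all insertions take place in an interval between two
endpoints. -/
def IsValid (D : Set ℕ+) : ChordCode → Prop
  | single d => d ∈ D
  | ins A B k => A.IsValid D ∧ B.IsValid D ∧ 1 ≤ k ∧ k < 2 * B.size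

/-- The insertion tree, with leaves `(d, 0)` for chords with decoration `d`. -/
def tree : ChordCode → InsTree
  | single d => .leaf (d, 0)
  | ins A B k => A.tree.insertAt B.tree k

/-- The monomial `â`. -/
def monomial {R : Type*} [CommMonoid R] (a : ℕ → ℕ → R) : ChordCode → R
  | single _ => 1
  -- Inside the composite, the terminal chord just before the base chord of `A` is the last chord of
  -- `B`, so the label gap of that base chord is `A.baseIndex - 1`.
  | ins A B _ => B.monomial a * (A.monomial a * a A.baseDec (A.baseIndex - 1))

/-- The splitting of a diagram along the root of its insertion tree: the diagram of the left
subtree, the number of its chords that come before the base chord, and the diagram of the right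
subtree. -/
def split : ChordCode → Option (ChordCode × ℕ × ChordCode)
  | single _ => none
  | ins A B k =>
    match B.split with
    | none => some (A, 1, B)
    | some (E, l, B') =>
      -- In pre-order, edge 1 of the tree of `B` is the virtual one, edges 2 to `2 * E.size` belong
      -- to the left subtree (which has `2 * E.size - 1` edges, counting the one above it), and the
      -- remaining ones to the right subtree.
      if k ≤ 1 then some (A, 1, B)
      else if k ≤ 2 * E.size then some (ins A E (k - 1), l + 1, B')
      else some (E, l, ins A B' (k - 2 * E.size))

theorem size_pos (C : ChordCode) : 0 < C.size := by
  cases C with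
  | single d => exact Nat.one_pos
  | ins A B k => have := size_pos A; simp only [size]; omega

theorem baseIndex_pos (C : ChordCode) : 0 < C.baseIndex := by
  cases C <;> simp [baseIndex]

theorem size_le_norm (C : ChordCode) : C.size ≤ C.norm := by
  induction C with
  | single d => exact d.pos
  | ins A B k hA hB => simp only [size, norm]; omega

theorem baseIndex_le_size (C : ChordCode) : C.baseIndex ≤ C.size := by
  induction C with
  | single d => exact le_rfl
  | ins A B k hA hB => have := A.size_pos; simp only [size, baseIndex]; omega

theorem baseIndex_le_norm (C : ChordCode) : C.baseIndex ≤ C.norm :=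
  C.baseIndex_le_size.trans C.size_le_norm

theorem baseDec_le_norm (C : ChordCode) : (C.baseDec : ℕ) ≤ C.norm := by
  induction C with
  | single d => exact le_rfl
  | ins A B k hA hB => simp only [norm, baseDec]; omega

theorem baseDec_mem {D : Set ℕ+} {C : ChordCode} (h : C.IsValid D) : C.baseDec ∈ D := by
  induction C with
  | single d => exact h
  | ins A B k hA hB => exact hB h.2.1

theorem _root_.InsTree.numVertices_insertAt (T T' : InsTree) (k : ℕ) :
    (T.insertAt T' k).numVertices = T.numVertices + T'.numVertices + 1 := by
  induction T' generalizing k with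
  | leaf c => simp only [InsTree.insertAt, InsTree.numVertices]; omega
  | node l r hl hr =>
    rw [InsTree.insertAt]
    split_ifs
    · simp only [InsTree.numVertices]; omega
    · simp only [InsTree.numVertices, hl]; omega
    · simp only [InsTree.numVertices, hr]; omega

/-- Translates the vertex counts used by `InsTree.insertAt` into the chord counts used by `split`.
-/
theorem numVertices_tree (C : ChordCode) : C.tree.numVertices + 1 = 2 * C.size := by
  induction C with
  | single d => rfl
  | ins A B k hA hB => simp only [tree, size, InsTree.numVertices_insertAt]; omega

theorem eq_single_of_split_eq_none {C : ChordCode} (h : C.split = none) :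
    C = single C.baseDec := by
  cases C with
  | single d => rfl
  | ins A B k =>
    rw [split] at h
    split at h
    · simp at h
    · split_ifs at h

/-- The relations between a diagram and the two parts of its splitting. -/
theorem split_spec {C E C' : ChordCode} {l : ℕ} (h : C.split = some (E, l, C')) :
    C.size = E.size + C'.size ∧ C.baseDec = C'.baseDec ∧ C.tree = .node E.tree C'.tree := by
  induction C generalizing E C' l with
  | single d => simp [split] at h
  | ins A B k hA hB =>
    rw [split] at h
    split at h
    · rename_i hs
      simp only [Option.some.injEq, Prod.mk.injEq] at h
      obtain ⟨rfl, rfl, rfl⟩ := h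
      refine ⟨rfl, rfl, ?_⟩
      rw [tree, eq_single_of_split_eq_none hs]
      rfl
    · rename_i E' l' B' hs
      obtain ⟨h1, h5, h6⟩ := hB hs
      have hv := E'.numVertices_tree
      have hE := E'.size_pos
      split_ifs at h with hk hk'
      all_goals
        simp only [Option.some.injEq, Prod.mk.injEq] at h
        obtain ⟨rfl, rfl, rfl⟩ := h
      · refine ⟨rfl, rfl, ?_⟩
        rw [tree, h6, InsTree.insertAt, if_pos hk]
      · refine ⟨by simp only [size]; omega, h5, ?_⟩
        rw [tree, h6, InsTree.insertAt, if_neg hk, if_pos (by omega), tree]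
      · refine ⟨by simp only [size]; omega, h5, ?_⟩
        rw [tree, h6, InsTree.insertAt, if_neg hk, if_neg (by omega), tree]
        congr 2
        omega

/-- An insertion into `E` raises both `E.baseIndex` and `l` by one, and an insertion into the right
part changes neither, so the gap `E.baseIndex - l` is frozen once the left part has been created
with `l = 1`. -/
theorem monomial_split {R : Type*} [CommMonoid R] (a : ℕ → ℕ → R) {C E C' : ChordCode} {l : ℕ}
    (h : C.split = some (E, l, C')) :
    C.monomial a = E.monomial a * a E.baseDec (E.baseIndex - l) * C'.monomial a := by
  induction C generalizing E C' l with
  | single d => simp [split] at h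
  | ins A B k hA hB =>
    rw [split] at h
    split at h
    · simp only [Option.some.injEq, Prod.mk.injEq] at h
      obtain ⟨rfl, rfl, rfl⟩ := h
      exact mul_comm _ _
    · rename_i E' l' B' hs
      have h4 := hB hs
      split_ifs at h with hk hk'
      all_goals
        simp only [Option.some.injEq, Prod.mk.injEq] at h
        obtain ⟨rfl, rfl, rfl⟩ := h
      · exact mul_comm _ _
      · simp only [monomial, h4, baseDec, baseIndex, Nat.add_sub_add_right]
        ac_rfl
      · simp only [monomial, h4]
        ac_rfl

/-- Both parts of an insertion have positive norm, hence smaller norm than the whole, and the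
insertion place is bounded by the size, thus by the norm. -/
theorem finite_isValid_norm_le (D : Set ℕ+) (N : ℕ) :
    {C : ChordCode | C.IsValid D ∧ C.norm ≤ N}.Finite := by
  induction N with
  | zero =>
    refine Set.finite_empty.subset fun C hC => ?_
    have := C.size_pos
    have := C.size_le_norm
    have := hC.2
    omega
  | succ N ih =>
    refine (((Set.finite_Iic (⟨N + 1, Nat.succ_pos N⟩ : ℕ+)).image single).union
      ((ih.prod (ih.prod (Set.finite_Iio (2 * N + 2)))).image
        fun p => ins p.1 p.2.1 p.2.2)).subset ?_
    rintro (d | ⟨A, B, k⟩) hC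
    · exact Or.inl ⟨d, by exact hC.2, rfl⟩
    · obtain ⟨⟨h1, h2, h3, h4⟩, h5⟩ := hC
      have hA := A.size_pos
      have hA' := A.size_le_norm
      have hB := B.size_pos
      have hB' := B.size_le_norm
      simp only [norm] at h5
      refine Or.inr ⟨(A, B, k), ⟨⟨h1, ?_⟩, ⟨h2, ?_⟩, ?_⟩, rfl⟩
      all_goals simp; omega

theorem finite_isValid_norm_eq (D : Set ℕ+) (N : ℕ) :
    {C : ChordCode | C.IsValid D ∧ C.norm = N}.Finite :=
  (finite_isValid_norm_le D N).subset fun _ h => ⟨h.1, h.2.le⟩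

/-- The valid codes of norm `N`. -/
noncomputable def ofNorm (D : Set ℕ+) (N : ℕ) : Finset ChordCode :=
  (finite_isValid_norm_eq D N).toFinset

@[simp] theorem mem_ofNorm {D : Set ℕ+} {N : ℕ} {C : ChordCode} :
    C ∈ ofNorm D N ↔ C.IsValid D ∧ C.norm = N := by
  simp [ofNorm]

open Finset in
theorem sum_ofNorm_of_single {M : Type*} [AddCommMonoid M] (D : Set ℕ+) (N : ℕ)
    (φ : ChordCode → M) (hφ : ∀ d, φ (single d) = 0) :
    ∑ C ∈ ofNorm D N, φ C = ∑ p ∈ antidiagonal N, ∑ A ∈ ofNorm D p.1, ∑ B ∈ ofNorm D p.2,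
      ∑ k ∈ Ico 1 (2 * B.size), φ (ins A B k) := by
  classical
  have h : ∀ p : ℕ × ℕ, ∑ A ∈ ofNorm D p.1, ∑ B ∈ ofNorm D p.2,
      ∑ k ∈ Ico 1 (2 * B.size), φ (ins A B k) =
      ∑ x ∈ ofNorm D p.1 ×ˢ (ofNorm D p.2).sigma fun B => Ico 1 (2 * B.size),
        φ (ins x.1 x.2.1 x.2.2) := by
    intro p
    rw [sum_product]
    exact sum_congr rfl fun A _ => (sum_sigma' _ _ _)
  simp only [h]
  rw [sum_sigma']
  symm
  refine sum_of_injOn (fun x => ins x.2.1 x.2.2.1 x.2.2.2) ?_ ?_ ?_ ?_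
  · rintro ⟨p, A, B, k⟩ h1 ⟨q, A', B', k'⟩ h2 h3
    simp only [ins.injEq] at h3
    obtain ⟨rfl, rfl, rfl⟩ := h3
    simp at h1 h2
    obtain ⟨p1, p2⟩ := p
    obtain ⟨q1, q2⟩ := q
    simp_all
  · rintro ⟨p, A, B, k⟩ h1
    simp at h1
    simp only [SetLike.mem_coe, mem_ofNorm, IsValid, norm]
    exact ⟨⟨h1.2.1.1, h1.2.2.1.1, h1.2.2.2⟩, by omega⟩
  · rintro (d | ⟨A, B, k⟩) h1 h2
    · exact hφ d
    · exfalso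
      apply h2
      simp only [mem_ofNorm, IsValid, norm] at h1
      refine ⟨⟨(A.norm, B.norm), A, B, k⟩, ?_, rfl⟩
      simp [h1]
  · intros; rfl

end ChordCode

/-! ### Generating series over codes and the binomial count of splittings. -/

namespace ChordCode

open Finset PowerSeries

variable {K : Type*} [Field K]

/-- The sum `∑_C x^‖C‖ h(C)` over all valid codes. -/
noncomputable def weightedSum (D : Set ℕ+) (h : ChordCode → PowerSeries K) : PowerSeries K :=
  -- The values `h C` are series themselves, so that such sums can be nested.
  PowerSeries.mk fun N => ∑ p ∈ antidiagonal N, ∑ C ∈ ofNorm D p.1, coeff p.2 (h C)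

theorem sum_antidiagonal_assoc {M : Type*} [AddCommMonoid M] (f : ℕ → ℕ → ℕ → M) (N : ℕ) :
    ∑ x ∈ antidiagonal N, ∑ y ∈ antidiagonal x.1, f y.1 y.2 x.2 =
      ∑ x ∈ antidiagonal N, ∑ y ∈ antidiagonal x.2, f x.1 y.1 y.2 := by
  rw [sum_sigma', sum_sigma']
  refine sum_nbij' (fun z => ⟨(z.2.1, z.2.2 + z.1.2), (z.2.2, z.1.2)⟩)
    (fun z => ⟨(z.1.1 + z.2.1, z.2.2), (z.1.1, z.2.1)⟩) ?_ ?_ ?_ ?_ ?_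
  · rintro ⟨⟨a, b⟩, c, d⟩ h
    simp at h ⊢
    omega
  · rintro ⟨⟨a, b⟩, c, d⟩ h
    simp at h ⊢
    omega
  · rintro ⟨⟨a, b⟩, c, d⟩ h
    simp at h
    simp [h.2]
  · rintro ⟨⟨a, b⟩, c, d⟩ h
    simp at h
    simp [h.2]
  · rintro ⟨⟨a, b⟩, c, d⟩ _
    rfl

variable {D : Set ℕ+}

theorem coeff_weightedSum (h : ChordCode → PowerSeries K) (N : ℕ) :
    coeff N (weightedSum D h) =
      ∑ p ∈ antidiagonal N, ∑ C ∈ ofNorm D p.1, coeff p.2 (h C) :=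
  coeff_mk _ _

theorem coeff_weightedSum_C (h : ChordCode → K) (N : ℕ) :
    coeff N (weightedSum D fun C => PowerSeries.C (h C)) = ∑ C ∈ ofNorm D N, h C := by
  rw [coeff_weightedSum, sum_eq_single_of_mem (N, 0) (by simp)]
  · simp
  · rintro ⟨p, q⟩ hp hne
    have hq : q ≠ 0 := by
      rintro rfl
      simp at hp
      exact hne (by rw [hp])
    simp [coeff_C, hq]

theorem weightedSum_add (h h' : ChordCode → PowerSeries K) :
    weightedSum D (fun C => h C + h' C) = weightedSum D h + weightedSum D h' := by
  ext N
  simp only [coeff_weightedSum, map_add, sum_add_distrib]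

theorem weightedSum_zero : weightedSum D (fun _ => (0 : PowerSeries K)) = 0 := by
  ext N
  simp only [coeff_weightedSum, map_zero, sum_const_zero]

theorem weightedSum_sum {ι : Type*} (s : Finset ι) (h : ι → ChordCode → PowerSeries K) :
    weightedSum D (fun C => ∑ i ∈ s, h i C) = ∑ i ∈ s, weightedSum D (h i) := by
  classical
  induction s using Finset.induction_on with
  | empty => simp only [sum_empty, weightedSum_zero]
  | insert i s hi ih => simp only [sum_insert hi, weightedSum_add, ih]

theorem weightedSum_mul (h : ChordCode → PowerSeries K) (c : PowerSeries K) :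
    weightedSum D (fun C => h C * c) = weightedSum D h * c := by
  ext N
  simp only [coeff_weightedSum, coeff_mul, sum_mul]
  rw [sum_antidiagonal_assoc fun i j k => ∑ C ∈ ofNorm D i, coeff j (h C) * coeff k c]
  exact sum_congr rfl fun p _ => sum_comm

theorem weightedSum_mul_left (c : PowerSeries K) (h : ChordCode → PowerSeries K) :
    weightedSum D (fun C => c * h C) = c * weightedSum D h := by
  simp only [mul_comm c, weightedSum_mul]

/-- Summation along the root share decomposition. -/
theorem weightedSum_of_single (h : ChordCode → PowerSeries K) (hh : ∀ d, h (single d) = 0) :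
    weightedSum D h = weightedSum D fun A => weightedSum D fun B =>
      ∑ k ∈ Ico 1 (2 * B.size), h (ins A B k) := by
  ext N
  simp only [coeff_weightedSum, map_sum]
  rw [sum_congr rfl fun (p : ℕ × ℕ) _ => sum_ofNorm_of_single D p.1 (fun C => coeff p.2 (h C))
      fun d => by rw [hh, map_zero],
    sum_antidiagonal_assoc fun i j k => ∑ A ∈ ofNorm D i, ∑ B ∈ ofNorm D j,
      ∑ l ∈ Ico 1 (2 * B.size), coeff k (h (ins A B l))]
  exact sum_congr rfl fun p _ => sum_comm

/-- The sum of `g` over all diagrams with base label `m + 1`. -/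
noncomputable def baseSum (D : Set ℕ+) (m : ℕ) (g : ChordCode → PowerSeries K) : PowerSeries K :=
  weightedSum D fun C => if C.baseIndex = m + 1 then g C else 0

/-- The sum of `f · l` over all diagrams with base label at least `l`, for `l ≥ 1`. -/
noncomputable def upperSum (D : Set ℕ+) (l : ℕ) (f : ChordCode → ℕ → PowerSeries K) :
    PowerSeries K :=
  if l = 0 then 0 else weightedSum D fun C => if l ≤ C.baseIndex then f C l else 0

/-- The value of `(E, l, C') ↦ f E l * g C'` at the splitting of `C`. -/
noncomputable def splitValue (f : ChordCode → ℕ → PowerSeries K) (g : ChordCode → PowerSeries K)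
    (C : ChordCode) : PowerSeries K :=
  match C.split with
  | none => 0
  | some (E, l, C') => f E l * g C'

/-- The sum of `g` over all insertions of `A`. -/
noncomputable def insertSum (A : ChordCode) (g : ChordCode → PowerSeries K) (B : ChordCode) :
    PowerSeries K :=
  ∑ k ∈ Ico 1 (2 * B.size), g (ins A B k)

/-- The sum of `f · (l + 1)` over all insertions of `A`. -/
noncomputable def insertSum₂ (A : ChordCode) (f : ChordCode → ℕ → PowerSeries K) (B : ChordCode)
    (l : ℕ) : PowerSeries K :=
  ∑ k ∈ Ico 1 (2 * B.size), f (ins A B k) (l + 1)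

/-- A product rule for the insertion of `A`: on edge 1 it creates a new left part `A`, on the other
edges it acts on the left or on the right part of the splitting of `B`. A single chord has only edge
1. -/
theorem insertSum_splitValue (f : ChordCode → ℕ → PowerSeries K) (g : ChordCode → PowerSeries K)
    (A B : ChordCode) :
    insertSum A (splitValue f g) B = f A 1 * g B +
      (splitValue (insertSum₂ A f) g B + splitValue f (insertSum A g) B) := by
  have hB := B.size_pos
  rw [insertSum]
  rcases hs : B.split with _ | ⟨E, l, B'⟩
  · have h1 : B.size = 1 := by
      rw [eq_single_of_split_eq_none hs]; rfl
    simp [h1, splitValue, split, hs]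
  · obtain ⟨h1, -⟩ := split_spec hs
    have hE := E.size_pos
    have hB' := B'.size_pos
    rw [h1, sum_eq_sum_Ico_succ_bot (by omega),
      ← sum_Ico_consecutive _ (show 1 + 1 ≤ 2 * E.size + 1 by omega)
        (show 2 * E.size + 1 ≤ 2 * (E.size + B'.size) by omega)]
    congr 1
    · simp [splitValue, split, hs]
    congr 1
    · simp only [splitValue, hs, insertSum₂, sum_mul]
      rw [← sum_Ico_add' _ 1 (2 * E.size) 1]
      refine sum_congr rfl fun k hk => ?_
      rw [mem_Ico] at hk
      simp only [split, hs, if_neg (show ¬ k + 1 ≤ 1 by omega),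
        if_pos (show k + 1 ≤ 2 * E.size by omega), Nat.add_sub_cancel]
    · simp only [splitValue, hs, insertSum, mul_sum]
      rw [show 2 * E.size + 1 = 1 + 2 * E.size by omega,
        show 2 * (E.size + B'.size) = 2 * B'.size + 2 * E.size by omega,
        ← sum_Ico_add' _ 1 (2 * B'.size) (2 * E.size)]
      refine sum_congr rfl fun k hk => ?_
      rw [mem_Ico] at hk
      simp only [split, hs, if_neg (show ¬ k + 2 * E.size ≤ 1 by omega),
        if_neg (show ¬ k + 2 * E.size ≤ 2 * E.size by omega), Nat.add_sub_cancel]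

theorem baseSum_add (m : ℕ) (g g' : ChordCode → PowerSeries K) :
    baseSum D m (fun C => g C + g' C) = baseSum D m g + baseSum D m g' := by
  rw [baseSum, baseSum, baseSum, ← weightedSum_add]
  congr 1
  funext C
  split_ifs <;> simp

theorem baseSum_mul_left (m : ℕ) (c : PowerSeries K) (g : ChordCode → PowerSeries K) :
    baseSum D m (fun C => c * g C) = c * baseSum D m g := by
  rw [baseSum, baseSum, ← weightedSum_mul_left]
  congr 1
  funext C
  split_ifs <;> simp

/-- The base chord of `ins A B k` is that of `B`, one label later; so removing the outermost
insertion lowers `m` by one and drives the induction on `m`. -/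
theorem baseSum_succ (m : ℕ) (g : ChordCode → PowerSeries K) :
    baseSum D (m + 1) g = weightedSum D fun A => baseSum D m (insertSum A g) := by
  rw [baseSum, weightedSum_of_single _ fun d => by simp [baseIndex]]
  congr 1
  funext A
  rw [baseSum]
  congr 1
  funext B
  rw [insertSum]
  simp only [baseIndex, Nat.add_right_cancel_iff]
  split_ifs <;> simp

theorem upperSum_zero (f : ChordCode → ℕ → PowerSeries K) : upperSum D 0 f = 0 := if_pos rfl

theorem upperSum_one (f : ChordCode → ℕ → PowerSeries K) :
    upperSum D 1 f = weightedSum D fun A => f A 1 := by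
  rw [upperSum, if_neg one_ne_zero]
  congr 1
  funext A
  exact if_pos A.baseIndex_pos

theorem upperSum_succ {l : ℕ} (hl : l ≠ 0) (f : ChordCode → ℕ → PowerSeries K) :
    upperSum D (l + 1) f = weightedSum D fun A => upperSum D l (insertSum₂ A f) := by
  simp only [upperSum, if_neg hl, if_neg l.succ_ne_zero]
  rw [weightedSum_of_single _ fun d => by simp [baseIndex, hl]]
  congr 1
  funext A
  congr 1
  funext B
  rw [insertSum₂]
  simp only [baseIndex, Nat.add_le_add_iff_right]
  split_ifs <;> simp

/-- The sum over all diagrams with base label `m + 1` that have a splitting is a binomial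
convolution. -/
theorem baseSum_splitValue (m : ℕ) (f : ChordCode → ℕ → PowerSeries K)
    (g : ChordCode → PowerSeries K) :
    baseSum D m (splitValue f g) =
      ∑ p ∈ antidiagonal m, (m.choose p.1 : PowerSeries K) *
        (upperSum D p.1 f * baseSum D p.2 g) := by
  induction m generalizing f g with
  | zero =>
    simp only [HasAntidiagonal.antidiagonal_zero, sum_singleton, upperSum_zero, zero_mul, mul_zero]
    -- Base label 1 forces a single chord, which has no splitting.
    refine Eq.trans (congrArg (weightedSum D) (funext fun C => ?_)) weightedSum_zero
    split_ifs with h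
    · rcases C with d | ⟨A, B, k⟩
      · rfl
      · have := B.baseIndex_pos
        simp only [baseIndex] at h
        omega
    · rfl
  | succ m ih =>
    -- Pascal's rule matches the product rule: the outermost inserted diagram enlarges the right
    -- part, or is one of the steps counted by `l` on the left.
    rw [baseSum_succ, sum_antidiagonal_choose_succ_mul fun i j => upperSum D i f * baseSum D j g]
    have h1 : ∀ A, baseSum D m (insertSum A (splitValue f g)) = f A 1 * baseSum D m g +
        (baseSum D m (splitValue (insertSum₂ A f) g) +
          baseSum D m (splitValue f (insertSum A g))) := by
      intro A
      rw [← baseSum_add, ← baseSum_mul_left, ← baseSum_add]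
      congr 1
      funext B
      exact insertSum_splitValue f g A B
    simp only [h1, weightedSum_add, weightedSum_mul, ih, weightedSum_sum, weightedSum_mul_left,
      baseSum_succ]
    rw [← add_assoc, add_comm]
    congr 1
    -- The summand with `p.1 = 0` is the creation of a new left part: `upperSum D 0` vanishes, so
    -- `upperSum_succ` does not cover `upperSum D 1`.
    have h2 : ∀ p ∈ antidiagonal m, (m.choose p.2 : PowerSeries K) *
        (upperSum D (p.1 + 1) f * baseSum D p.2 g) =
        (if p = (0, m) then (weightedSum D fun A => f A 1) * baseSum D m g else 0) +
        (m.choose p.1 : PowerSeries K) *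
          ((weightedSum D fun A => upperSum D p.1 (insertSum₂ A f)) * baseSum D p.2 g) := by
      rintro ⟨p, q⟩ hp
      rw [HasAntidiagonal.mem_antidiagonal] at hp
      simp only at hp ⊢
      rw [← Nat.choose_symm_of_eq_add hp.symm]
      rcases Nat.eq_zero_or_pos p with rfl | h
      · obtain rfl : q = m := by omega
        simp [upperSum_one, upperSum_zero, weightedSum_zero]
      · rw [if_neg (by simp; omega), upperSum_succ h.ne', zero_add]
    rw [sum_congr rfl h2, sum_add_distrib, sum_ite_eq', if_pos (by simp)]

end ChordCode

/-! ### The functional equation of the series and its iteration. -/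

namespace ChordCode

open Finset PowerSeries

variable {K : Type*} [Field K] (D : Set ℕ+) (a w : ℕ → ℕ → K)

/-- The contribution of a diagram to `gComb`, as a function of the diagram and of the index. -/
def term (C : ChordCode) (l : ℕ) : K :=
  C.tree.weight w 0 * C.monomial a * a C.baseDec (C.baseIndex - l)

/-- The contribution of a diagram whose base chord has decoration `d`, without the factor belonging
to the base chord, and with `j` edges above the root of the insertion tree. -/
noncomputable def partialTerm (j : ℕ) (d : ℕ+) (C : ChordCode) : K :=
  if C.baseDec = d then C.tree.weight w j * C.monomial a else 0

/-- The exponential generating series of the sums of `partialTerm`. -/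
noncomputable def partialSeries (j : ℕ) (d : ℕ+) : PowerSeries (PowerSeries K) :=
  PowerSeries.mk fun m => PowerSeries.C ((m.factorial : K)⁻¹) *
    baseSum D m fun C => PowerSeries.C (partialTerm a w j d C)

/-- The exponential generating series of the sums of `term`. -/
noncomputable def upperSeries : PowerSeries (PowerSeries K) :=
  PowerSeries.mk fun l => PowerSeries.C ((l.factorial : K)⁻¹) *
    upperSum D l fun C l => PowerSeries.C (term a w C l)

/-- The left subtree starts leftward paths afresh, whereas paths ending at the root of the right
subtree continue along one more edge; hence 0 on the left and `j + 1` on the right. -/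
theorem partialTerm_of_split {C E C' : ChordCode} {l : ℕ} (h : C.split = some (E, l, C')) (j : ℕ)
    (d : ℕ+) : partialTerm a w j d C = term a w E l * partialTerm a w (j + 1) d C' := by
  obtain ⟨-, h5, h6⟩ := split_spec h
  rw [partialTerm, partialTerm, h5]
  split_ifs
  · rw [monomial_split a h, h6, InsTree.weight, term]
    ring
  · simp

variable {D}

open scoped Classical in
theorem baseSum_single {d : ℕ+} (hd : d ∈ D) (m : ℕ) (c : K) :
    baseSum D m (fun C => if C = single d then PowerSeries.C c else 0) =
      if m = 0 then PowerSeries.X ^ (d : ℕ) * PowerSeries.C c else 0 := by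
  have h1 : (baseSum D m fun C => if C = single d then PowerSeries.C c else 0) =
      weightedSum D fun C => PowerSeries.C
        (if C = single d then (if m = 0 then c else 0) else 0) := by
    rw [baseSum]
    congr 1
    funext C
    by_cases hC : C = single d
    · subst hC
      by_cases hm : m = 0
      · simp [baseIndex, hm]
      · simp [baseIndex, hm]
    · simp [hC]
  rw [h1]
  ext N
  rw [coeff_weightedSum_C, sum_ite_eq']
  simp only [mem_ofNorm, IsValid, hd, true_and, norm]
  by_cases hm : m = 0
  · simp only [hm, if_true, coeff_X_pow_mul', coeff_C]
    by_cases hN : (d : ℕ) = N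
    · simp [hN]
    · rw [if_neg hN]
      split_ifs <;> first | rfl | omega
  · simp [hm]

/-- A code is a single chord or has a splitting. In the second case the factorials in the two
exponential series turn the binomial convolution of `baseSum_splitValue` into a product. -/
theorem partialSeries_eq [CharZero K] {d : ℕ+} (hd : d ∈ D) (j : ℕ) :
    partialSeries D a w j d = PowerSeries.C (PowerSeries.X ^ (d : ℕ) * PowerSeries.C (w d j)) +
      upperSeries D a w * partialSeries D a w (j + 1) d := by
  classical
  have hterm : (fun C => PowerSeries.C (partialTerm a w j d C)) = fun C =>
      (if C = single d then PowerSeries.C (w d j) else 0) +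
      splitValue (fun C l => PowerSeries.C (term a w C l))
        (fun C => PowerSeries.C (partialTerm a w (j + 1) d C)) C := by
    funext C
    rcases hs : C.split with _ | ⟨E, l, C'⟩
    · rw [eq_single_of_split_eq_none hs]
      by_cases h : C.baseDec = d
      · simp [partialTerm, splitValue, split, h, baseDec, tree, monomial, InsTree.weight]
      · simp [partialTerm, splitValue, split, h, baseDec]
    · rw [partialTerm_of_split a w hs, if_neg, zero_add, map_mul]
      · simp [splitValue, hs]
      · rintro rfl
        simp [split] at hs
  ext1 m
  rw [map_add, partialSeries, coeff_mk, hterm, baseSum_add, baseSum_single hd, mul_add,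
    baseSum_splitValue, coeff_C]
  congr 1
  · split_ifs with h
    · simp [h]
    · simp
  · rw [coeff_mul, mul_sum]
    refine sum_congr rfl fun p hp => ?_
    rw [HasAntidiagonal.mem_antidiagonal] at hp
    rw [upperSeries, coeff_mk, partialSeries, coeff_mk, ← map_natCast (PowerSeries.C (R := K)),
      ← mul_assoc, ← map_mul]
    have hc : ((m.factorial : K)⁻¹ * (m.choose p.1 : K)) =
        (p.1.factorial : K)⁻¹ * (p.2.factorial : K)⁻¹ := by
      rw [← hp, Nat.choose_symm_add, Nat.add_choose,
        Nat.cast_div (Nat.factorial_mul_factorial_dvd_factorial_add _ _)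
          (Nat.cast_ne_zero.2 (mul_ne_zero (Nat.factorial_ne_zero _) (Nat.factorial_ne_zero _)))]
      have := Nat.cast_ne_zero (R := K).2 (Nat.factorial_ne_zero (p.1 + p.2))
      field_simp
      push_cast
      field_simp
    rw [hc, map_mul]
    ring

theorem coeff_upperSeries_zero : coeff 0 (upperSeries D a w) = 0 := by
  rw [upperSeries, coeff_mk, upperSum_zero, mul_zero]

theorem partialSeries_eq_sum [CharZero K] {d : ℕ+} (hd : d ∈ D) (j M : ℕ) :
    partialSeries D a w j d =
      ∑ n ∈ range M, PowerSeries.C (PowerSeries.X ^ (d : ℕ) * PowerSeries.C (w d (j + n))) *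
        upperSeries D a w ^ n + upperSeries D a w ^ M * partialSeries D a w (j + M) d := by
  induction M with
  | zero => simp
  | succ M ih =>
    rw [ih, sum_range_succ, partialSeries_eq a w hd (j + M)]
    rw [← add_assoc]
    ring

theorem coeff_pow_eq_zero_of_lt {R : Type*} [CommSemiring R] {G : PowerSeries R}
    (hG : coeff 0 G = 0) {m n : ℕ} (h : m < n) : coeff m (G ^ n) = 0 := by
  have h1 : (PowerSeries.X : PowerSeries R) ^ n ∣ G ^ n :=
    pow_dvd_pow_of_dvd (X_dvd_iff.2 (by rwa [← coeff_zero_eq_constantCoeff_apply])) n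
  exact X_pow_dvd_iff.1 h1 m h

/-- After `m + 1` iterations the remainder contains the factor `upperSeries D a w ^ (m + 1)`, which
has no term of degree `m` in the derivation symbol. -/
theorem baseSum_partialTerm [CharZero K] {d : ℕ+} (hd : d ∈ D) (m : ℕ) :
    (baseSum D m fun C => PowerSeries.C (partialTerm a w 0 d C)) =
      PowerSeries.C (m.factorial : K) * ∑ n ∈ range (m + 1),
        PowerSeries.X ^ (d : ℕ) * PowerSeries.C (w d n) * coeff m (upperSeries D a w ^ n) := by
  have h := congrArg (coeff m) (partialSeries_eq_sum a w hd 0 (m + 1))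
  rw [map_add, map_sum, coeff_mul m (upperSeries D a w ^ (m + 1)),
    sum_eq_zero (s := antidiagonal m), add_zero, partialSeries, coeff_mk] at h
  · simp only [coeff_C_mul, zero_add] at h
    rw [← h, ← mul_assoc, ← map_mul, mul_inv_cancel₀ (Nat.cast_ne_zero.2 m.factorial_ne_zero),
      map_one, one_mul]
  · intro p hp
    rw [HasAntidiagonal.mem_antidiagonal] at hp
    rw [coeff_pow_eq_zero_of_lt (coeff_upperSeries_zero a w) (by omega), zero_mul]

theorem coeff_upperSum_term {l : ℕ} (hl : l ≠ 0) (i : ℕ) :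
    coeff i (upperSum D l fun C l => PowerSeries.C (term a w C l)) =
      ∑ C ∈ ofNorm D i with l ≤ C.baseIndex, term a w C l := by
  rw [upperSum, if_neg hl, sum_filter, ← coeff_weightedSum_C]
  congr 2
  funext C
  split_ifs <;> simp

theorem coeff_coeff_upperSeries {i l : ℕ} (h : i < l) :
    coeff i (coeff l (upperSeries D a w)) = 0 := by
  rw [upperSeries, coeff_mk, coeff_C_mul, coeff_upperSum_term a w (by omega), sum_eq_zero, mul_zero]
  intro C hC
  simp only [mem_filter, mem_ofNorm] at hC
  have := C.baseIndex_le_norm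
  omega

/-- The condition that the coefficient of degree `m` be divisible by $x^m$ is multiplicative: if
`p.1 + p.2` exceeds `q.1 + q.2`, then `p.1 > q.1` or `p.2 > q.2`. -/
theorem coeff_coeff_pow {R : Type*} [CommSemiring R] {G : PowerSeries (PowerSeries R)}
    (hG : ∀ {i l}, i < l → coeff i (coeff l G) = 0) (n : ℕ) {i m : ℕ} (h : i < m) :
    coeff i (coeff m (G ^ n)) = 0 := by
  induction n generalizing i m with
  | zero => rw [pow_zero, coeff_one, if_neg (by omega), map_zero]
  | succ n ih =>
    rw [pow_succ, coeff_mul, map_sum]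
    refine sum_eq_zero fun p hp => ?_
    rw [coeff_mul]
    refine sum_eq_zero fun q hq => ?_
    rw [HasAntidiagonal.mem_antidiagonal] at hp hq
    rcases lt_or_ge q.1 p.1 with h1 | h1
    · rw [ih h1, zero_mul]
    · rw [hG (by omega : q.2 < p.2), mul_zero]

theorem derivAtZero_mk (f : ℕ → K) (m : ℕ) :
    derivAtZero m (PowerSeries.mk f) = m.factorial * f m := by
  rw [derivAtZero, ← coeff_zero_eq_constantCoeff_apply, coeff_iterate_derivative]
  simp

variable (D) in
/-- The value of the `n`-th power of the operator at the series with coefficients `a d`. -/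
noncomputable def powerValue (n d : ℕ) : PowerSeries K :=
  PowerSeries.mk fun i => ∑ m ∈ range (i + 1),
    coeff i (coeff m (upperSeries D a w ^ n) * PowerSeries.C (derivAtZero m (fTilde a d)))

theorem hasOperatorValue_powerValue (n d : ℕ) :
    HasOperatorValue (upperSeries D a w ^ n) (fTilde a d) (powerValue D a w n d) := by
  intro i
  have hsupp : (Function.support fun m => coeff i (coeff m (upperSeries D a w ^ n) *
      PowerSeries.C (derivAtZero m (fTilde a d)))) ⊆ (range (i + 1) : Finset ℕ) := by
    intro m hm
    by_contra h
    rw [coe_range, Set.mem_Iio] at h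
    refine hm ?_
    beta_reduce
    rw [coeff_mul_C, coeff_coeff_pow (coeff_coeff_upperSeries a w) n (by omega), zero_mul]
  refine ⟨(finite_toSet _).subset hsupp, ?_⟩
  rw [finsum_eq_sum_of_support_subset _ hsupp, powerValue, coeff_mk]

theorem coeff_powerValue_of_lt {i n : ℕ} (h : i < n) (d : ℕ) :
    coeff i (powerValue D a w n d) = 0 := by
  rw [powerValue, coeff_mk]
  refine sum_eq_zero fun m hm => ?_
  rw [mem_range] at hm
  rw [coeff_pow_eq_zero_of_lt (coeff_upperSeries_zero a w) (by omega), zero_mul, map_zero]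

/-- The lemma for codes, with arbitrary leaf weights `w`. Diagrams are grouped by decoration `d` and
label `m + 1` of the base chord; the factor `a d m` left out of `partialTerm` is supplied by the
`m`-th derivative, whose `m!` is that of `baseSum_partialTerm`. -/
theorem hasFormalSum_powerValue [CharZero K] {S : PowerSeries K}
    (hS : ∀ i, coeff i S = ∑ C ∈ ofNorm D i, term a w C 1) :
    HasFormalSum (fun p : D × ℕ => (PowerSeries.X : PowerSeries K) ^ ((p.1 : ℕ+) : ℕ) *
      PowerSeries.C (w (p.1 : ℕ+) p.2) * powerValue D a w p.2 (p.1 : ℕ+)) S := by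
  classical
  intro i
  have hfin : {d : D | ((d : ℕ+) : ℕ) ≤ i}.Finite :=
    (Set.finite_Iic i).preimage (f := fun d : D => ((d : ℕ+) : ℕ))
      (fun x _ y _ h => Subtype.ext (PNat.coe_injective h))
  have hco : ∀ p : D × ℕ, coeff i ((PowerSeries.X : PowerSeries K) ^ ((p.1 : ℕ+) : ℕ) *
      PowerSeries.C (w (p.1 : ℕ+) p.2) * powerValue D a w p.2 (p.1 : ℕ+)) =
      if ((p.1 : ℕ+) : ℕ) ≤ i then w (p.1 : ℕ+) p.2 *
        coeff (i - (p.1 : ℕ+)) (powerValue D a w p.2 (p.1 : ℕ+)) else 0 := by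
    intro p
    rw [mul_assoc, coeff_X_pow_mul']
    split_ifs
    · rw [coeff_C_mul]
    · rfl
  have hsupp : (Function.support fun p : D × ℕ => coeff i ((PowerSeries.X : PowerSeries K) ^
      ((p.1 : ℕ+) : ℕ) * PowerSeries.C (w (p.1 : ℕ+) p.2) * powerValue D a w p.2 (p.1 : ℕ+))) ⊆
      (hfin.toFinset ×ˢ range (i + 1) : Finset (D × ℕ)) := by
    rintro ⟨d, n⟩ hp
    rw [Function.mem_support, hco] at hp
    by_cases hd : ((d : ℕ+) : ℕ) ≤ i
    · by_cases hn : n < i + 1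
      · simpa [hd] using hn
      · rw [if_pos hd, coeff_powerValue_of_lt a w (by omega), mul_zero] at hp
        exact absurd rfl hp
    · rw [if_neg hd] at hp
      exact absurd rfl hp
  refine ⟨(finite_toSet _).subset hsupp, ?_⟩
  rw [finsum_eq_sum_of_support_subset _ hsupp, sum_product, hS]
  have hterm : ∀ C ∈ ofNorm D i, term a w C 1 = ∑ d ∈ hfin.toFinset, ∑ m ∈ range (i + 1),
      a (d : ℕ+) m * if C.baseIndex = m + 1 then partialTerm a w 0 d C else 0 := by
    intro C hC
    obtain ⟨hv, hN⟩ := mem_ofNorm.1 hC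
    have h1 := C.baseDec_le_norm
    have h2 := C.baseIndex_le_norm
    have h3 := C.baseIndex_pos
    rw [sum_eq_single_of_mem ⟨C.baseDec, baseDec_mem hv⟩ (by simp; omega),
      sum_eq_single_of_mem (C.baseIndex - 1) (by simp; omega)]
    · rw [if_pos (by omega), partialTerm, if_pos rfl, term, mul_comm]
    · intro m _ hm
      rw [if_neg (by omega), mul_zero]
    · intro d _ hd
      refine sum_eq_zero fun m _ => ?_
      rw [partialTerm, if_neg (c := C.baseDec = (d : ℕ+)) fun h => hd (Subtype.ext h.symm),
        ite_self, mul_zero]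
  rw [sum_congr rfl hterm]
  conv_rhs => rw [sum_comm]
  refine sum_congr rfl fun d hd => ?_
  have hdi : ((d : ℕ+) : ℕ) ≤ i := by simpa using hd
  conv_rhs => rw [sum_comm]
  have hcoeff : ∀ m, ∑ C ∈ ofNorm D i,
      (a (d : ℕ+) m * if C.baseIndex = m + 1 then partialTerm a w 0 d C else 0) =
      ∑ n ∈ range (i + 1), w (d : ℕ+) n * coeff (i - (d : ℕ+))
        (coeff m (upperSeries D a w ^ n) * PowerSeries.C (derivAtZero m (fTilde a (d : ℕ+)))) := by
    intro m
    have h1 := congrArg (coeff i) (baseSum_partialTerm a w d.2 m)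
    have h2 : (baseSum D m fun C => PowerSeries.C (partialTerm a w 0 d C)) =
        weightedSum D fun C => PowerSeries.C
          (if C.baseIndex = m + 1 then partialTerm a w 0 d C else 0) := by
      rw [baseSum]
      congr 1
      funext C
      split_ifs <;> simp
    rw [h2, coeff_weightedSum_C, coeff_C_mul, map_sum] at h1
    rw [← mul_sum, h1, fTilde, derivAtZero_mk, mul_sum, mul_sum]
    have h3 : ∀ n, a (d : ℕ+) m * ((m.factorial : K) * coeff i (PowerSeries.X ^ ((d : ℕ+) : ℕ) *
        PowerSeries.C (w (d : ℕ+) n) * coeff m (upperSeries D a w ^ n))) =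
        w (d : ℕ+) n * coeff (i - (d : ℕ+)) (coeff m (upperSeries D a w ^ n) *
          PowerSeries.C ((m.factorial : K) * a (d : ℕ+) m)) := by
      intro n
      rw [mul_assoc (PowerSeries.X ^ _), coeff_X_pow_mul', if_pos hdi, coeff_C_mul, coeff_mul_C]
      ring
    simp only [h3]
    -- For `m ≤ i` the summands with `m < n ≤ i` vanish, as the operator has no constant term; for
    -- `m > i` every summand on either side is zero by divisibility by powers of $x$.
    rcases le_or_gt m i with hm | hm
    · refine sum_subset (range_mono (by omega)) fun n _ hn => ?_
      rw [mem_range, not_lt] at hn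
      rw [coeff_pow_eq_zero_of_lt (coeff_upperSeries_zero a w) (by omega), zero_mul, map_zero,
        mul_zero]
    · rw [sum_eq_zero, sum_eq_zero]
      all_goals
        intro n _
        rw [coeff_mul_C, coeff_coeff_pow (coeff_coeff_upperSeries a w) n (by omega), zero_mul,
          mul_zero]
  rw [sum_congr rfl fun m _ => hcoeff m]
  conv_rhs => rw [sum_comm]
  refine sum_congr rfl fun n _ => ?_
  rw [hco, if_pos hdi, powerValue, coeff_mk, mul_sum]
  -- The factor $x^d$ lowers the degree to `i - d`, where only `m ≤ i - d` contributes.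
  refine sum_subset (range_mono (Nat.succ_le_succ (Nat.sub_le _ _))) fun m _ hm => ?_
  rw [mem_range, not_lt] at hm
  rw [coeff_mul_C, coeff_coeff_pow (coeff_coeff_upperSeries a w) n (by omega), zero_mul, mul_zero]

end ChordCode

/-! ### Connected diagrams and root share decompositions. -/

/-- The chords of `S` have pairwise distinct endpoints, the smaller one first. -/
structure IsDiagram (S : Finset Chord) : Prop where
  lt : ∀ c ∈ S, c.1 < c.2
  disjoint : ∀ c ∈ S, ∀ e ∈ S, c ≠ e → c.1 ≠ e.1 ∧ c.1 ≠ e.2 ∧ c.2 ≠ e.1 ∧ c.2 ≠ e.2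

/-- `A` contains every chord of `S` that crosses one of its chords. -/
def CrossClosed (S A : Finset Chord) : Prop :=
  ∀ c ∈ A, ∀ e ∈ S, c.Crosses e → e ∈ A

/-- `S` is nonempty and not the union of two nonempty parts that do not cross. -/
def IsConn (S : Finset Chord) : Prop :=
  S.Nonempty ∧ ∀ A ⊆ S, A.Nonempty → CrossClosed S A → A = S

theorem IsDiagram.subset {S A : Finset Chord} (h : IsDiagram S) (hA : A ⊆ S) : IsDiagram A :=
  ⟨fun c hc => h.lt c (hA hc), fun c hc e he => h.disjoint c (hA hc) e (hA he)⟩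

theorem CrossClosed.mem_of_reachable {S A : Finset Chord} (h : CrossClosed S A) {c e : S}
    (hc : c.1 ∈ A) (hce : (intersectionGraph S).Reachable c e) : e.1 ∈ A := by
  obtain ⟨p⟩ := hce
  induction p with
  | nil => exact hc
  | cons hadj _ ih => exact ih (h _ hc _ (Subtype.prop _) hadj)

theorem connected_iff_isConn (S : Finset Chord) :
    (intersectionGraph S).Connected ↔ IsConn S := by
  classical
  constructor
  · intro h
    obtain ⟨c⟩ := h.nonempty
    refine ⟨⟨c.1, c.2⟩, fun A hA ⟨e, he⟩ hcl => hA.antisymm fun x hx => ?_⟩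
    exact hcl.mem_of_reachable (c := ⟨e, hA he⟩) (e := ⟨x, hx⟩) he (h.preconnected _ _)
  · rintro ⟨⟨c, hc⟩, h⟩
    have : Nonempty S := ⟨⟨c, hc⟩⟩
    refine ⟨fun x y => ?_⟩
    have := h (S.filter fun z => ∃ hz : z ∈ S, (intersectionGraph S).Reachable x ⟨z, hz⟩)
      (Finset.filter_subset _ _) ⟨x, Finset.mem_filter.2 ⟨x.2, x.2, .refl _⟩⟩ ?_
    · exact (Finset.mem_filter.1 (this.symm.subset y.2)).2.2
    · intro z hz e he hze
      obtain ⟨hz, hz', hr⟩ := Finset.mem_filter.1 hz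
      refine Finset.mem_filter.2 ⟨he, he, hr.trans (SimpleGraph.Adj.reachable ?_)⟩
      exact hze

theorem rootChord_fst_le {S : Finset Chord} {c : Chord} (hc : c ∈ S) : (rootChord S).1 ≤ c.1 := by
  have h : S.Nonempty := ⟨c, hc⟩
  rw [rootChord, dif_pos h]
  exact (S.exists_min_image Prod.fst h).choose_spec.2 c hc

theorem IsDiagram.eq_of_fst_eq {S : Finset Chord} (h : IsDiagram S) {c e : Chord} (hc : c ∈ S)
    (he : e ∈ S) (hce : c.1 = e.1) : c = e := by
  by_contra hne
  exact (h.disjoint c hc e he hne).1 hce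

theorem IsDiagram.rootChord_lt {S : Finset Chord} (h : IsDiagram S) {c : Chord} (hc : c ∈ S)
    (hne : c ≠ rootChord S) : (rootChord S).1 < c.1 :=
  lt_of_le_of_ne (rootChord_fst_le hc) fun heq =>
    hne (h.eq_of_fst_eq hc (rootChord_mem ⟨c, hc⟩) heq.symm)

theorem IsDiagram.rootChord_eq {S : Finset Chord} (h : IsDiagram S) {r : Chord} (hr : r ∈ S)
    (hmin : ∀ c ∈ S, r.1 ≤ c.1) : rootChord S = r :=
  h.eq_of_fst_eq (rootChord_mem ⟨r, hr⟩) hr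
    ((rootChord_fst_le hr).antisymm (hmin _ (rootChord_mem ⟨r, hr⟩)))

theorem crossClosed_rootComponent (S : Finset Chord) : CrossClosed S (rootComponent S) := by
  classical
  intro c hc e he hce
  obtain ⟨hcS, hr, hc', hreach⟩ := Finset.mem_filter.1 hc
  refine Finset.mem_filter.2 ⟨he, hr, he, hreach.trans (SimpleGraph.Adj.reachable ?_)⟩
  exact hce

theorem isConn_rootComponent {S : Finset Chord} (h : S.Nonempty) : IsConn (rootComponent S) := by
  classical
  refine ⟨⟨_, rootChord_mem_rootComponent h⟩, fun A hA ⟨c, hc⟩ hcl => hA.antisymm fun e he => ?_⟩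
  have hcl' : CrossClosed S A := fun x hx y hy hxy =>
    hcl x hx y (crossClosed_rootComponent S x (hA hx) y hy hxy) hxy
  obtain ⟨hcS, hr, hc', hc''⟩ := Finset.mem_filter.1 (hA hc)
  obtain ⟨heS, hr', he', he''⟩ := Finset.mem_filter.1 he
  exact hcl'.mem_of_reachable (c := ⟨c, hcS⟩) (e := ⟨e, heS⟩) hc (hc''.symm.trans he'')

/-- The root component lies in the closed set `A` and is a nonempty closed subset of it, so
connectedness of `A` forces equality. Components can thus be recognised without paths. -/
theorem rootComponent_eq {S A : Finset Chord} (hA : A ⊆ S) (hconn : IsConn A)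
    (hcl : CrossClosed S A) (hr : rootChord S ∈ A) : rootComponent S = A := by
  classical
  have hS : S.Nonempty := ⟨_, hA hr⟩
  refine hconn.2 _ (fun e he => ?_) ⟨_, rootChord_mem_rootComponent hS⟩ fun c hc e he =>
    crossClosed_rootComponent S c hc e (hA he)
  obtain ⟨heS, hr', he', he''⟩ := Finset.mem_filter.1 he
  exact hcl.mem_of_reachable (c := ⟨_, hr'⟩) (e := ⟨e, heS⟩) hr he''

theorem IsConn.rootComponent_eq {S : Finset Chord} (h : IsConn S) : rootComponent S = S :=
  _root_.rootComponent_eq Finset.Subset.rfl h (fun _ _ _ he _ => he) (rootChord_mem h.1)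

/-- If no chord of a connected diagram crosses `e`, its chords are all enclosed by `e` or not at
all. -/
theorem IsConn.enclosed {F : Finset Chord} (h : IsConn F) (hlt : ∀ f ∈ F, f.1 < f.2) {e : Chord}
    (he : ∀ f ∈ F, ¬ e.Crosses f) (hne : ∀ f ∈ F, f.1 ≠ e.1 ∧ f.2 ≠ e.2)
    {f : Chord} (hf : f ∈ F) (h1 : e.1 < f.1) (h2 : f.2 < e.2) :
    ∀ f' ∈ F, e.1 < f'.1 ∧ f'.2 < e.2 := by
  classical
  have := h.2 (F.filter fun f => e.1 < f.1 ∧ f.2 < e.2) (Finset.filter_subset _ _)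
    ⟨f, Finset.mem_filter.2 ⟨hf, h1, h2⟩⟩ ?_
  · intro f' hf'
    rw [← this] at hf'
    exact (Finset.mem_filter.1 hf').2
  -- A chord that crosses an enclosed one has an endpoint inside `e`; not crossing `e`, it lies
  -- inside entirely.
  · intro c hc d hd hcd
    obtain ⟨hcF, hc1, hc2⟩ := Finset.mem_filter.1 hc
    refine Finset.mem_filter.2 ⟨hd, ?_⟩
    have h3 := he d hd
    have h4 := hne d hd
    have h5 := hlt d hd
    have h6 := hlt c hcF
    unfold Chord.Crosses at hcd h3
    omega

/-- The properties of a root share decomposition `S = S' ∘ₖ F`, where `S'` has root chord `r`. -/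
structure IsRootShare (S S' F : Finset Chord) (r : Chord) : Prop where
  union : ∀ c, c ∈ S ↔ c ∈ S' ∨ c ∈ F
  disjoint : ∀ c ∈ S', c ∉ F
  isDiagram : IsDiagram S
  conn_left : IsConn S'
  conn_right : IsConn F
  root_mem : r ∈ S'
  root_lt : ∀ c ∈ S, c ≠ r → r.1 < c.1
  first : ∀ c ∈ S', c ≠ r → (rootChord F).1 < c.1
  not_crosses : ∀ c ∈ S', c ≠ r → ∀ f ∈ F, ¬ c.Crosses f
  crosses : ∃ f ∈ F, r.Crosses f

/-- Existence of the decomposition; `IsRootShare.firstComponent_eq` gives its uniqueness. -/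
theorem isRootShare_firstComponent {S : Finset Chord} (hd : IsDiagram S) (hc : IsConn S)
    (hn : S.Nontrivial) :
    IsRootShare S (S \ firstComponent S) (firstComponent S) (rootChord S) := by
  classical
  have hE : (S.erase (rootChord S)).Nonempty := hn.erase_nonempty
  have hsub : firstComponent S ⊆ S.erase (rootChord S) := rootComponent_subset _
  have hFS : firstComponent S ⊆ S := (firstComponent_ssubset hc.1).subset
  have hcl : CrossClosed (S.erase (rootChord S)) (firstComponent S) := crossClosed_rootComponent _
  have hFc : IsConn (firstComponent S) := isConn_rootComponent hE
  have hrF : rootChord S ∉ firstComponent S := fun h => Finset.notMem_erase _ _ (hsub h)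
  have hrm : rootChord S ∈ S := rootChord_mem hc.1
  have hroot : rootChord (S.erase (rootChord S)) ∈ firstComponent S :=
    rootChord_mem_rootComponent hE
  have hnot : ∀ c ∈ S \ firstComponent S, c ≠ rootChord S → ∀ f ∈ firstComponent S,
      ¬ c.Crosses f := by
    intro c hc hcr f hf hcf
    rw [Finset.mem_sdiff] at hc
    exact hc.2 (hcl f hf c (Finset.mem_erase.2 ⟨hcr, hc.1⟩) hcf.symm)
  have hcross : ∃ f ∈ firstComponent S, (rootChord S).Crosses f := by
    by_contra! hno
    have := hc.2 (firstComponent S) hFS hFc.1 fun f hf e he hfe => by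
      by_cases her : e = rootChord S
      · exact absurd (her ▸ hfe.symm) (hno f hf)
      · exact hcl f hf e (Finset.mem_erase.2 ⟨her, he⟩) hfe
    exact hrF (this.symm.subset hrm)
  refine ⟨fun c => ?_, fun c hc => (Finset.mem_sdiff.1 hc).2, hd, ⟨?_, ?_⟩, hFc,
    rootChord_mem_sdiff_firstComponent hc.1, fun c hc hcr => hd.rootChord_lt hc hcr, ?_, hnot,
    hcross⟩
  · rw [Finset.mem_sdiff]
    by_cases hcF : c ∈ firstComponent S
    · simp only [hcF, hFS hcF, or_true]
    · simp only [hcF, or_false, not_false_eq_true, and_true]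
  · exact ⟨_, rootChord_mem_sdiff_firstComponent hc.1⟩
  · intro A hA hAne hAcl
    -- Only the root chord links the two parts. A closed part of the rest is therefore closed in `S`
    -- if it avoids the root chord, and becomes closed after adding the first component if it
    -- contains it.
    by_cases hrA : rootChord S ∈ A
    · have h := hc.2 (A ∪ firstComponent S) (Finset.union_subset (hA.trans Finset.sdiff_subset) hFS)
        (hAne.mono Finset.subset_union_left) ?_
      · refine hA.antisymm fun c hc => ?_
        rw [Finset.mem_sdiff] at hc
        exact (Finset.mem_union.1 (h.symm.subset hc.1)).resolve_right hc.2
      · intro c hc e he hce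
        rw [Finset.mem_union] at hc ⊢
        by_cases heF : e ∈ firstComponent S
        · exact Or.inr heF
        by_cases her : e = rootChord S
        · exact Or.inl (her ▸ hrA)
        rcases hc with hc | hc
        · exact Or.inl (hAcl c hc e (Finset.mem_sdiff.2 ⟨he, heF⟩) hce)
        · exact Or.inr (hcl c hc e (Finset.mem_erase.2 ⟨her, he⟩) hce)
    · exfalso
      have h := hc.2 A (hA.trans Finset.sdiff_subset) hAne ?_
      · exact hrA (h ▸ hrm)
      · intro c hc e he hce
        by_cases heF : e ∈ firstComponent S
        · exact absurd hce (hnot c (hA hc) (fun h => hrA (h ▸ hc)) e heF)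
        · exact hAcl c hc e (Finset.mem_sdiff.2 ⟨he, heF⟩) hce
  · intro c hc hcr
    rw [Finset.mem_sdiff] at hc
    have h1 : rootChord (firstComponent S) = rootChord (S.erase (rootChord S)) :=
      (hd.subset hFS).rootChord_eq hroot fun f hf => rootChord_fst_le (hsub hf)
    rw [h1]
    refine (hd.subset (Finset.erase_subset _ _)).rootChord_lt
      (Finset.mem_erase.2 ⟨hcr, hc.1⟩) fun h => hc.2 (h ▸ hroot)

/-- The endpoints of the chords of `S`. -/
def endpoints (S : Finset Chord) : Finset ℕ := S.image Prod.fst ∪ S.image Prod.snd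

theorem mem_endpoints {S : Finset Chord} {x : ℕ} :
    x ∈ endpoints S ↔ ∃ c ∈ S, c.1 = x ∨ c.2 = x := by
  simp only [endpoints, Finset.mem_union, Finset.mem_image]
  constructor
  · rintro (⟨c, hc, h⟩ | ⟨c, hc, h⟩)
    exacts [⟨c, hc, Or.inl h⟩, ⟨c, hc, Or.inr h⟩]
  · rintro ⟨c, hc, h | h⟩
    exacts [Or.inl ⟨c, hc, h⟩, Or.inr ⟨c, hc, h⟩]

theorem fst_mem_endpoints {S : Finset Chord} {c : Chord} (hc : c ∈ S) : c.1 ∈ endpoints S :=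
  mem_endpoints.2 ⟨c, hc, Or.inl rfl⟩

theorem snd_mem_endpoints {S : Finset Chord} {c : Chord} (hc : c ∈ S) : c.2 ∈ endpoints S :=
  mem_endpoints.2 ⟨c, hc, Or.inr rfl⟩

theorem endpoints_union (S T : Finset Chord) : endpoints (S ∪ T) = endpoints S ∪ endpoints T := by
  ext x
  simp only [mem_endpoints, Finset.mem_union]
  constructor
  · rintro ⟨c, hc | hc, h⟩
    exacts [Or.inl ⟨c, hc, h⟩, Or.inr ⟨c, hc, h⟩]
  · rintro (⟨c, hc, h⟩ | ⟨c, hc, h⟩)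
    exacts [⟨c, Or.inl hc, h⟩, ⟨c, Or.inr hc, h⟩]

theorem IsDiagram.card_endpoints {S : Finset Chord} (h : IsDiagram S) :
    (endpoints S).card = 2 * S.card := by
  rw [endpoints, Finset.card_union_of_disjoint, Finset.card_image_of_injOn,
    Finset.card_image_of_injOn, two_mul]
  · intro c hc e he hce
    by_contra hne
    exact (h.disjoint c hc e he hne).2.2.2 hce
  · intro c hc e he hce
    exact h.eq_of_fst_eq hc he hce
  · rw [Finset.disjoint_left]
    intro x hx hx'
    obtain ⟨c, hc, rfl⟩ := Finset.mem_image.1 hx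
    obtain ⟨e, he, hce⟩ := Finset.mem_image.1 hx'
    by_cases hne : c = e
    · subst hne
      exact (h.lt c hc).ne' hce
    · exact (h.disjoint c hc e he hne).2.1 hce.symm

theorem insertionIndex_eq (S : Finset Chord) : insertionIndex S =
    ((endpoints (firstComponent S)).filter (· < (rootChord S).2)).card := rfl

namespace IsRootShare

variable {S S' F : Finset Chord} {r : Chord}

theorem subset_left (h : IsRootShare S S' F r) : S' ⊆ S := fun c hc => (h.union c).2 (Or.inl hc)

theorem subset_right (h : IsRootShare S S' F r) : F ⊆ S := fun c hc => (h.union c).2 (Or.inr hc)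

theorem diagram_left (h : IsRootShare S S' F r) : IsDiagram S' := h.isDiagram.subset h.subset_left

theorem diagram_right (h : IsRootShare S S' F r) : IsDiagram F :=
  h.isDiagram.subset h.subset_right

theorem eq_union (h : IsRootShare S S' F r) : S = S' ∪ F := by
  ext c
  rw [Finset.mem_union, h.union]

theorem root_notMem (h : IsRootShare S S' F r) : r ∉ F := h.disjoint r h.root_mem

theorem ne_root (h : IsRootShare S S' F r) {f : Chord} (hf : f ∈ F) : f ≠ r := fun hfr =>
  h.root_notMem (hfr ▸ hf)

theorem card_eq (h : IsRootShare S S' F r) : S.card = S'.card + F.card := by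
  rw [h.eq_union, Finset.card_union_of_disjoint (Finset.disjoint_left.2 h.disjoint)]

theorem nontrivial (h : IsRootShare S S' F r) : S.Nontrivial := by
  obtain ⟨f, hf⟩ := h.conn_right.1
  exact ⟨r, h.subset_left h.root_mem, f, h.subset_right hf, (h.ne_root hf).symm⟩

theorem rootChord_eq (h : IsRootShare S S' F r) : rootChord S = r :=
  h.isDiagram.rootChord_eq (h.subset_left h.root_mem) fun c hc => by
    by_cases hcr : c = r
    · rw [hcr]
    · exact (h.root_lt c hc hcr).le

theorem rootChord_left (h : IsRootShare S S' F r) : rootChord S' = r :=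
  h.diagram_left.rootChord_eq h.root_mem fun c hc => by
    by_cases hcr : c = r
    · rw [hcr]
    · exact (h.root_lt c (h.subset_left hc) hcr).le

theorem isConn (h : IsRootShare S S' F r) : IsConn S := by
  classical
  refine ⟨⟨r, h.subset_left h.root_mem⟩, fun A hA ⟨x, hx⟩ hcl => hA.antisymm ?_⟩
  obtain ⟨f, hf, hrf⟩ := h.crosses
  have h1 : ∀ x ∈ A, x ∈ S' → S' ⊆ A := fun x hx hx' => by
    have := h.conn_left.2 (A ∩ S') Finset.inter_subset_right ⟨x, Finset.mem_inter.2 ⟨hx, hx'⟩⟩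
      fun c hc e he hce => Finset.mem_inter.2
        ⟨hcl c (Finset.mem_inter.1 hc).1 e (h.subset_left he) hce, he⟩
    exact Finset.inter_eq_right.1 this
  have h2 : ∀ x ∈ A, x ∈ F → F ⊆ A := fun x hx hx' => by
    have := h.conn_right.2 (A ∩ F) Finset.inter_subset_right ⟨x, Finset.mem_inter.2 ⟨hx, hx'⟩⟩
      fun c hc e he hce => Finset.mem_inter.2
        ⟨hcl c (Finset.mem_inter.1 hc).1 e (h.subset_right he) hce, he⟩
    exact Finset.inter_eq_right.1 this
  have h3 : r ∈ A ∧ f ∈ A := by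
    rcases (h.union x).1 (hA hx) with hx' | hx'
    · have hr := h1 x hx hx' h.root_mem
      exact ⟨hr, hcl r hr f (h.subset_right hf) hrf⟩
    · have hf := h2 x hx hx' hf
      exact ⟨hcl f hf r (h.subset_left h.root_mem) hrf.symm, hf⟩
  intro c hc
  rcases (h.union c).1 hc with hc' | hc'
  exacts [h1 r h3.1 h.root_mem hc', h2 f h3.2 hf hc']

theorem rootComponent_erase (h : IsRootShare S S' F r) : rootComponent (S.erase r) = F := by
  have hsub : F ⊆ S.erase r := fun f hf => Finset.mem_erase.2 ⟨h.ne_root hf, h.subset_right hf⟩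
  refine rootComponent_eq hsub h.conn_right (fun f hf e he hfe => ?_) ?_
  · rw [Finset.mem_erase] at he
    rcases (h.union e).1 he.2 with he' | he'
    · exact absurd hfe.symm (h.not_crosses e he' he.1 f hf)
    · exact he'
  · have hmem := rootChord_mem h.conn_right.1
    rw [(h.isDiagram.subset (Finset.erase_subset _ _)).rootChord_eq (hsub hmem)]
    · exact hmem
    · intro c hc
      rw [Finset.mem_erase] at hc
      rcases (h.union c).1 hc.2 with hc' | hc'
      · exact (h.first c hc' hc.1).le
      · exact rootChord_fst_le hc'

theorem firstComponent_eq (h : IsRootShare S S' F r) : firstComponent S = F := by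
  rw [firstComponent, h.rootChord_eq, h.rootComponent_erase]

theorem sdiff_eq (h : IsRootShare S S' F r) : S \ F = S' := by
  ext c
  rw [Finset.mem_sdiff, h.union]
  have := h.disjoint c
  by_cases hc : c ∈ S'
  · simp only [hc, this hc, true_or, not_false_eq_true, and_self]
  · simp only [hc, false_or, and_not_self]

theorem insertionIndex_eq (h : IsRootShare S S' F r) :
    insertionIndex S = ((endpoints F).filter (· < r.2)).card := by
  rw [_root_.insertionIndex_eq, h.firstComponent_eq, h.rootChord_eq]

theorem insertionTree_eq (h : IsRootShare S S' F r) :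
    insertionTree S = (insertionTree S').insertAt (insertionTree F) (insertionIndex S) := by
  rw [insertionTree, dif_pos h.nontrivial, h.firstComponent_eq, h.sdiff_eq]

/-- An endpoint of `F` lies between no two endpoints of `S'` other than the first one. -/
theorem lt_iff (h : IsRootShare S S' F r) {p : ℕ} (hp : p ∈ endpoints F) :
    (∀ c ∈ S', c.2 < p ↔ r.2 < p) ∧ ∀ c ∈ S', c ≠ r → (c.1 < p ↔ r.2 < p) := by
  classical
  obtain ⟨f, hf, hfp⟩ := mem_endpoints.1 hp
  have hne : ∀ c ∈ S', ∀ f ∈ F, c.1 ≠ f.1 ∧ c.1 ≠ f.2 ∧ c.2 ≠ f.1 ∧ c.2 ≠ f.2 := fun c hc f hf =>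
    h.isDiagram.disjoint c (h.subset_left hc) f (h.subset_right hf)
      fun hcf => h.disjoint c hc (hcf ▸ hf)
  have hltF := h.diagram_right.lt
  have hltS := h.diagram_left.lt
  -- A chord `c ≠ r` of `S'` around `p` would enclose `f`, as they do not cross, and then all of the
  -- connected `F`, although the root chord of `F` starts before `c`.
  have hgap : ∀ c ∈ S', c ≠ r → (c.1 < p ↔ c.2 < p) := by
    intro c hc hcr
    have hcross := h.not_crosses c hc hcr f hf
    have hcf := hne c hc f hf
    have h1 := hltF f hf
    have h2 := hltS c hc
    have h3 : ¬ (c.1 < f.1 ∧ f.2 < c.2) := by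
      rintro ⟨h3, h4⟩
      have h5 := h.conn_right.enclosed hltF (h.not_crosses c hc hcr)
        (fun f hf => ⟨(hne c hc f hf).1.symm, (hne c hc f hf).2.2.2.symm⟩) hf h3 h4 _
        (rootChord_mem h.conn_right.1)
      have h6 := h.first c hc hcr
      omega
    unfold Chord.Crosses at hcross
    omega
  -- Hence the chords of `S'` that end before `p` form a closed set, which is empty or everything
  -- since `S'` is connected.
  have hcl : ∀ c ∈ S', ∀ e ∈ S', c.Crosses e → c.2 < p → e.2 < p := by
    intro c hc e he hce hcp
    have h1 := hltS c hc
    have h2 := hltS e he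
    have h3 := h.root_lt c (h.subset_left hc)
    have h4 := h.root_lt e (h.subset_left he)
    have h5 := hgap c hc
    have h6 := hgap e he
    unfold Chord.Crosses at hce
    by_cases hcr : c = r
    · by_cases her : e = r
      · subst hcr her
        exact hcp
      · subst hcr
        have := h4 her
        have := h6 her
        omega
    · have := h3 hcr
      have := h5 hcr
      by_cases her : e = r
      · subst her
        omega
      · have := h6 her
        omega
  have hall : ∀ c ∈ S', c.2 < p → ∀ e ∈ S', e.2 < p := by
    intro c hc hcp e he
    have := h.conn_left.2 (S'.filter fun c => c.2 < p) (Finset.filter_subset _ _)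
      ⟨c, Finset.mem_filter.2 ⟨hc, hcp⟩⟩ fun x hx y hy hxy => by
        rw [Finset.mem_filter] at hx ⊢
        exact ⟨hy, hcl x hx.1 y hy hxy hx.2⟩
    exact (Finset.mem_filter.1 (this.symm.subset he)).2
  have h1 : ∀ c ∈ S', c.2 < p ↔ r.2 < p := fun c hc =>
    ⟨fun hcp => hall c hc hcp r h.root_mem, fun hrp => hall r h.root_mem hrp c hc⟩
  exact ⟨h1, fun c hc hcr => (hgap c hc hcr).trans (h1 c hc)⟩

theorem insertionIndex_pos (h : IsRootShare S S' F r) : 1 ≤ insertionIndex S := by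
  obtain ⟨f, hf, hrf⟩ := h.crosses
  have h1 := h.root_lt f (h.subset_right hf) (h.ne_root hf)
  rw [h.insertionIndex_eq, Nat.one_le_iff_ne_zero, ← Nat.pos_iff_ne_zero, Finset.card_pos]
  refine ⟨f.1, Finset.mem_filter.2 ⟨fst_mem_endpoints hf, ?_⟩⟩
  unfold Chord.Crosses at hrf
  omega

/-- A chord `f` of `F` crossed by the root chord has its second endpoint after `r.2`, so that one is
not counted. -/
theorem insertionIndex_lt (h : IsRootShare S S' F r) : insertionIndex S < 2 * F.card := by
  obtain ⟨f, hf, hrf⟩ := h.crosses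
  have h1 := h.root_lt f (h.subset_right hf) (h.ne_root hf)
  rw [h.insertionIndex_eq, ← h.diagram_right.card_endpoints]
  refine Finset.card_lt_card (Finset.filter_ssubset.2 ⟨f.2, snd_mem_endpoints hf, ?_⟩)
  unfold Chord.Crosses at hrf
  omega

end IsRootShare

/-- Induction along root share decompositions. -/
theorem isConn_induction {P : Finset Chord → Prop} (single : ∀ c : Chord, c.1 < c.2 → P {c})
    (share : ∀ S S' F r, IsRootShare S S' F r → P S' → P F → P S) {S : Finset Chord}
    (hd : IsDiagram S) (hc : IsConn S) : P S := by
  induction hn : S.card using Nat.strong_induction_on generalizing S with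
  | _ n ih =>
    rcases hc.1.exists_eq_singleton_or_nontrivial with ⟨c, rfl⟩ | hnt
    · exact single c (hd.lt c (Finset.mem_singleton_self c))
    · have h := isRootShare_firstComponent hd hc hnt
      have h1 := h.card_eq
      have h2 := h.conn_left.1.card_pos
      have h3 := h.conn_right.1.card_pos
      exact share _ _ _ _ h (ih _ (by omega) h.diagram_left h.conn_left rfl)
        (ih _ (by omega) h.diagram_right h.conn_right rfl)

/-! ### Intersection order, terminal chords and base chord under a decomposition. -/

theorem intersectionOrder_empty : intersectionOrder ∅ = [] := by
  rw [intersectionOrder, dif_neg Finset.not_nonempty_empty]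

theorem IsConn.intersectionOrder_eq {S : Finset Chord} (h : IsConn S) :
    intersectionOrder S = rootChord S :: intersectionOrder (S.erase (rootChord S)) := by
  rw [intersectionOrder, dif_pos h.1, h.rootComponent_eq, Finset.sdiff_self,
    intersectionOrder_empty, List.append_nil]

theorem intersectionOrder_eq_append {S : Finset Chord} (hd : IsDiagram S) (h : S.Nonempty) :
    intersectionOrder S =
      intersectionOrder (rootComponent S) ++ intersectionOrder (S \ rootComponent S) := by
  have h1 : rootChord (rootComponent S) = rootChord S :=
    (hd.subset (rootComponent_subset S)).rootChord_eq (rootChord_mem_rootComponent h)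
      fun c hc => rootChord_fst_le (rootComponent_subset S hc)
  rw [intersectionOrder, dif_pos h, (isConn_rootComponent h).intersectionOrder_eq, h1,
    List.cons_append]

theorem mem_terminalChords {S : Finset Chord} {c : Chord} :
    c ∈ terminalChords S ↔ c ∈ S ∧ ∀ e ∈ S, c.1 < e.1 → ¬ c.Crosses e := by
  classical
  exact Finset.mem_filter

namespace IsRootShare

variable {S S' F : Finset Chord} {r : Chord}

theorem intersectionOrder_left (h : IsRootShare S S' F r) :
    intersectionOrder S' = r :: intersectionOrder (S'.erase r) := by
  rw [h.conn_left.intersectionOrder_eq, h.rootChord_left]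

/-- This governs all labels: those of `F` move up by 1, those of `S'` other than the root chord by
`F.card`. -/
theorem intersectionOrder_eq (h : IsRootShare S S' F r) :
    intersectionOrder S = r :: (intersectionOrder F ++ intersectionOrder (S'.erase r)) := by
  have hne : (S.erase r).Nonempty :=
    h.conn_right.1.mono fun f hf => Finset.mem_erase.2 ⟨h.ne_root hf, h.subset_right hf⟩
  have h1 : S.erase r \ F = S'.erase r := by
    rw [← h.sdiff_eq, Finset.erase_sdiff_comm]
  rw [h.isConn.intersectionOrder_eq, h.rootChord_eq,
    intersectionOrder_eq_append (h.isDiagram.subset (Finset.erase_subset _ _)) hne,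
    h.rootComponent_erase, h1]

end IsRootShare

theorem isConn_singleton (c : Chord) : IsConn {c} :=
  ⟨Finset.singleton_nonempty c, fun _ hA hne _ => (Finset.Nonempty.subset_singleton_iff hne).1 hA⟩

theorem rootChord_singleton (c : Chord) : rootChord {c} = c :=
  Finset.mem_singleton.1 (rootChord_mem (Finset.singleton_nonempty c))

theorem intersectionOrder_spec {S : Finset Chord} (hd : IsDiagram S) (hc : IsConn S) :
    (intersectionOrder S).Nodup ∧ ∀ c, c ∈ intersectionOrder S ↔ c ∈ S := by
  refine isConn_induction (P := fun S => (intersectionOrder S).Nodup ∧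
    ∀ c, c ∈ intersectionOrder S ↔ c ∈ S) ?_ ?_ hd hc
  · intro c _
    rw [(isConn_singleton c).intersectionOrder_eq, rootChord_singleton, Finset.erase_singleton,
      intersectionOrder_empty]
    simp
  · rintro S S' F r h ⟨h1, h2⟩ ⟨h3, h4⟩
    rw [h.intersectionOrder_left] at h1 h2
    rw [List.nodup_cons] at h1
    have h5 : ∀ c, c ∈ intersectionOrder (S'.erase r) ↔ c ∈ S' ∧ c ≠ r := by
      intro c
      have := h2 c
      rw [List.mem_cons] at this
      constructor
      · intro hc
        exact ⟨this.1 (Or.inr hc), fun hcr => h1.1 (hcr ▸ hc)⟩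
      · rintro ⟨hc, hcr⟩
        exact (this.2 hc).resolve_left hcr
    rw [h.intersectionOrder_eq]
    constructor
    · rw [List.nodup_cons, List.nodup_append', List.mem_append]
      refine ⟨?_, h3, h1.2, ?_⟩
      · rw [h4, h5]
        exact fun hr => hr.elim h.root_notMem fun hr => hr.2 rfl
      · intro c hc hc'
        exact h.disjoint c ((h5 c).1 hc').1 ((h4 c).1 hc)
    · intro c
      rw [List.mem_cons, List.mem_append, h4, h5, h.union]
      constructor
      · rintro (rfl | hc | hc)
        exacts [Or.inl h.root_mem, Or.inr hc, Or.inl hc.1]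
      · rintro (hc | hc)
        · by_cases hcr : c = r
          exacts [Or.inl hcr, Or.inr (Or.inr ⟨hc, hcr⟩)]
        · exact Or.inr (Or.inl hc)

theorem length_intersectionOrder {S : Finset Chord} (hd : IsDiagram S) (hc : IsConn S) :
    (intersectionOrder S).length = S.card := by
  obtain ⟨h1, h2⟩ := intersectionOrder_spec hd hc
  rw [← List.toFinset_card_of_nodup h1]
  congr 1
  ext c
  rw [List.mem_toFinset, h2]

theorem chordLabel_pos (S : Finset Chord) (c : Chord) : 1 ≤ chordLabel S c := Nat.le_add_left _ _

theorem chordLabel_le {S : Finset Chord} (hd : IsDiagram S) (hc : IsConn S) {c : Chord}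
    (hcS : c ∈ S) : chordLabel S c ≤ S.card := by
  rw [← length_intersectionOrder hd hc]
  exact List.idxOf_lt_length_iff.2 (((intersectionOrder_spec hd hc).2 c).2 hcS)

theorem chordLabel_injOn {S : Finset Chord} (hd : IsDiagram S) (hc : IsConn S) {c e : Chord}
    (hcS : c ∈ S) (h : chordLabel S c = chordLabel S e) : c = e :=
  (List.idxOf_inj (((intersectionOrder_spec hd hc).2 c).2 hcS)).1 (Nat.add_right_cancel h)

theorem baseChord_spec {S : Finset Chord} (h : S.Nonempty) :
    baseChord S ∈ terminalChords S ∧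
      ∀ e ∈ terminalChords S, chordLabel S (baseChord S) ≤ chordLabel S e := by
  rw [baseChord, dif_pos h]
  exact ((terminalChords S).exists_min_image (chordLabel S) (terminalChords_nonempty h)).choose_spec

theorem baseChord_eq {S : Finset Chord} (hd : IsDiagram S) (hc : IsConn S) {c : Chord}
    (hcS : c ∈ terminalChords S) (hmin : ∀ e ∈ terminalChords S, chordLabel S c ≤ chordLabel S e) :
    baseChord S = c := by
  have h := baseChord_spec hc.1
  exact chordLabel_injOn hd hc (baseChord_mem hc.1) ((h.2 c hcS).antisymm (hmin _ h.1))

theorem prevTerminalLabel_eq {S : Finset Chord} {c p : Chord} (hp : p ∈ terminalChords S)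
    (hpc : chordLabel S p < chordLabel S c)
    (hmax : ∀ q ∈ terminalChords S, chordLabel S q < chordLabel S c →
      chordLabel S q ≤ chordLabel S p) :
    prevTerminalLabel S c = chordLabel S p := by
  refine le_antisymm (Finset.sup_le fun x hx => ?_) ?_
  · obtain ⟨hx, hxc⟩ := Finset.mem_filter.1 hx
    obtain ⟨q, hq, rfl⟩ := Finset.mem_image.1 hx
    exact hmax q hq hxc
  · exact Finset.le_sup (f := id) (Finset.mem_filter.2 ⟨Finset.mem_image_of_mem _ hp, hpc⟩)

theorem exists_prevTerminal {S : Finset Chord} (hd : IsDiagram S) (hc : IsConn S) {c : Chord}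
    (hcS : c ∈ terminalChords S) (hcb : c ≠ baseChord S) :
    ∃ p ∈ terminalChords S, chordLabel S p < chordLabel S c ∧
      ∀ q ∈ terminalChords S, chordLabel S q < chordLabel S c →
        chordLabel S q ≤ chordLabel S p := by
  have hb := baseChord_spec hc.1
  have hlt : chordLabel S (baseChord S) < chordLabel S c :=
    lt_of_le_of_ne (hb.2 c hcS) fun h =>
      hcb (chordLabel_injOn hd hc (mem_terminalChords.1 hcS).1 h.symm)
  obtain ⟨p, hp, hmax⟩ := ((terminalChords S).filter fun q => chordLabel S q < chordLabel S c)
    |>.exists_max_image (chordLabel S) ⟨_, Finset.mem_filter.2 ⟨hb.1, hlt⟩⟩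
  rw [Finset.mem_filter] at hp
  exact ⟨p, hp.1, hp.2, fun q hq hqc => hmax q (Finset.mem_filter.2 ⟨hq, hqc⟩)⟩

namespace IsRootShare

variable {S S' F : Finset Chord} {r : Chord}

theorem chordLabel_left_root (h : IsRootShare S S' F r) : chordLabel S' r = 1 := by
  rw [chordLabel, h.intersectionOrder_left, List.idxOf_cons_self]

theorem chordLabel_right (h : IsRootShare S S' F r) {f : Chord} (hf : f ∈ F) :
    chordLabel S f = chordLabel F f + 1 := by
  rw [chordLabel, chordLabel, h.intersectionOrder_eq, List.idxOf_cons_ne _ (h.ne_root hf).symm,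
    List.idxOf_append_of_mem (((intersectionOrder_spec h.diagram_right h.conn_right).2 f).2 hf)]

theorem chordLabel_left (h : IsRootShare S S' F r) {c : Chord} (hc : c ∈ S') (hcr : c ≠ r) :
    chordLabel S c = chordLabel S' c + F.card := by
  rw [chordLabel, chordLabel, h.intersectionOrder_eq, h.intersectionOrder_left,
    List.idxOf_cons_ne _ hcr.symm, List.idxOf_cons_ne _ hcr.symm,
    List.idxOf_append_of_notMem fun hm => h.disjoint c hc
      (((intersectionOrder_spec h.diagram_right h.conn_right).2 c).1 hm),
    length_intersectionOrder h.diagram_right h.conn_right]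
  omega

theorem root_notMem_terminalChords (h : IsRootShare S S' F r) : r ∉ terminalChords S := by
  obtain ⟨f, hf, hrf⟩ := h.crosses
  exact fun hr => (mem_terminalChords.1 hr).2 f (h.subset_right hf)
    (h.root_lt f (h.subset_right hf) (h.ne_root hf)) hrf

theorem mem_terminalChords_right (h : IsRootShare S S' F r) {f : Chord} (hf : f ∈ F) :
    f ∈ terminalChords S ↔ f ∈ terminalChords F := by
  rw [mem_terminalChords, mem_terminalChords]
  refine ⟨fun ⟨_, h1⟩ => ⟨hf, fun e he => h1 e (h.subset_right he)⟩,
    fun ⟨_, h1⟩ => ⟨h.subset_right hf, fun e he hfe hcr => ?_⟩⟩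
  rcases (h.union e).1 he with he' | he'
  · by_cases her : e = r
    · subst her
      exact absurd hfe (h.root_lt f (h.subset_right hf) (h.ne_root hf)).not_gt
    · exact h.not_crosses e he' her f hf hcr.symm
  · exact h1 e he' hfe hcr

theorem mem_terminalChords_left (h : IsRootShare S S' F r) {c : Chord} (hc : c ∈ S')
    (hcr : c ≠ r) : c ∈ terminalChords S ↔ c ∈ terminalChords S' := by
  rw [mem_terminalChords, mem_terminalChords]
  refine ⟨fun ⟨_, h1⟩ => ⟨hc, fun e he => h1 e (h.subset_left he)⟩,
    fun ⟨_, h1⟩ => ⟨h.subset_left hc, fun e he hce hcross => ?_⟩⟩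
  rcases (h.union e).1 he with he' | he'
  · exact h1 e he' hce hcross
  · exact h.not_crosses c hc hcr e he' hcross

/-- The root chord of `S'` is terminal in `S'` only if there is no other chord. -/
theorem eq_singleton_of_root_mem (h : IsRootShare S S' F r) (hr : r ∈ terminalChords S') :
    S' = {r} := by
  refine (h.conn_left.2 {r} (Finset.singleton_subset_iff.2 h.root_mem)
    (Finset.singleton_nonempty r) ?_).symm
  intro c hc e he hce
  rw [Finset.mem_singleton] at hc ⊢
  subst hc
  by_contra her
  exact (mem_terminalChords.1 hr).2 e he (h.root_lt e (h.subset_left he) her) hce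

/-- The root chord of `S` is not terminal, and every chord of `F` precedes the remaining chords of
`S'`; terminality inside `F` is unaffected by the rest. -/
theorem baseChord_eq (h : IsRootShare S S' F r) : baseChord S = baseChord F := by
  have hb := baseChord_spec h.conn_right.1
  have hbF := (mem_terminalChords.1 hb.1).1
  refine _root_.baseChord_eq h.isDiagram h.isConn ((h.mem_terminalChords_right hbF).2 hb.1) ?_
  intro e he
  have heS := (mem_terminalChords.1 he).1
  have her : e ≠ r := fun her => h.root_notMem_terminalChords (her ▸ he)
  rw [h.chordLabel_right hbF]
  rcases (h.union e).1 heS with he' | he'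
  · rw [h.chordLabel_left he' her]
    have := chordLabel_le h.diagram_right h.conn_right hbF
    have := chordLabel_pos S' e
    omega
  · rw [h.chordLabel_right he']
    have := hb.2 e ((h.mem_terminalChords_right he').1 he)
    omega

theorem chordLabel_baseChord (h : IsRootShare S S' F r) :
    chordLabel S (baseChord S) = chordLabel F (baseChord F) + 1 := by
  rw [h.baseChord_eq, h.chordLabel_right (baseChord_mem h.conn_right.1)]

end IsRootShare

theorem baseChord_singleton (c : Chord) : baseChord {c} = c :=
  Finset.mem_singleton.1 (baseChord_mem (Finset.singleton_nonempty c))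

theorem chordLabel_singleton (c : Chord) : chordLabel {c} c = 1 := by
  rw [chordLabel, (isConn_singleton c).intersectionOrder_eq, rootChord_singleton,
    List.idxOf_cons_self]

theorem terminalChords_singleton (c : Chord) : terminalChords {c} = {c} := by
  ext e
  rw [mem_terminalChords, Finset.mem_singleton]
  refine ⟨fun h => h.1, fun h => ⟨h, fun d hd hlt => ?_⟩⟩
  rw [Finset.mem_singleton] at hd
  subst h hd
  exact absurd hlt (lt_irrefl _)

/-- The last chord in intersection order is terminal. -/
theorem exists_terminal_last {S : Finset Chord} (hd : IsDiagram S) (hc : IsConn S) :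
    ∃ c ∈ terminalChords S, chordLabel S c = S.card := by
  refine isConn_induction (P := fun S => ∃ c ∈ terminalChords S, chordLabel S c = S.card)
    ?_ ?_ hd hc
  · intro c _
    refine ⟨c, ?_, ?_⟩
    · rw [terminalChords_singleton, Finset.mem_singleton]
    · rw [chordLabel_singleton, Finset.card_singleton]
  · rintro S S' F r h ⟨c, hc, hc'⟩ ⟨f, hf, hf'⟩
    rw [h.card_eq]
    by_cases hcr : c = r
    · subst hcr
      have hfF := (mem_terminalChords.1 hf).1
      refine ⟨f, (h.mem_terminalChords_right hfF).2 hf, ?_⟩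
      rw [h.chordLabel_right hfF, hf', h.eq_singleton_of_root_mem hc, Finset.card_singleton,
        add_comm]
    · have hcS := (mem_terminalChords.1 hc).1
      refine ⟨c, (h.mem_terminalChords_left hcS hcr).2 hc, ?_⟩
      rw [h.chordLabel_left hcS hcr, hc']

/-! ### The monomial under a root share decomposition. -/

section Monomial

variable {R : Type*} [CommMonoid R] (a : ℕ → ℕ → R) (dec : Chord → ℕ+)

open scoped Classical in
/-- The factor of the chord `c` in the monomial `â`. -/
noncomputable def monomialFactor (S : Finset Chord) (c : Chord) : R :=
  if c ∈ terminalChords S then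
    if c = baseChord S then 1 else a (dec c) (chordLabel S c - prevTerminalLabel S c)
  else a (dec c) 0

theorem monomialFactor_right {S S' F : Finset Chord} {r : Chord} (h : IsRootShare S S' F r)
    {f : Chord} (hf : f ∈ F) : monomialFactor a dec S f = monomialFactor a dec F f := by
  rw [monomialFactor, monomialFactor, h.baseChord_eq]
  by_cases ht : f ∈ terminalChords F
  · rw [if_pos ((h.mem_terminalChords_right hf).2 ht), if_pos ht]
    by_cases hb : f = baseChord F
    · rw [if_pos hb, if_pos hb]
    · rw [if_neg hb, if_neg hb]
      obtain ⟨p, hp, hpf, hmax⟩ := exists_prevTerminal h.diagram_right h.conn_right ht hb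
      have hpF := (mem_terminalChords.1 hp).1
      rw [prevTerminalLabel_eq hp hpf hmax,
        prevTerminalLabel_eq (S := S) ((h.mem_terminalChords_right hpF).2 hp)
          (by rw [h.chordLabel_right hpF, h.chordLabel_right hf]; omega),
        h.chordLabel_right hpF, h.chordLabel_right hf, Nat.add_sub_add_right]
      intro q hq hqf
      have hqr : q ≠ r := fun hqr => h.root_notMem_terminalChords (hqr ▸ hq)
      have hfl := chordLabel_le h.diagram_right h.conn_right hf
      rw [h.chordLabel_right hf] at hqf
      rw [h.chordLabel_right hpF]
      rcases (h.union q).1 (mem_terminalChords.1 hq).1 with hq' | hq'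
      · rw [h.chordLabel_left hq' hqr] at hqf
        have := chordLabel_pos S' q
        omega
      · rw [h.chordLabel_right hq'] at hqf ⊢
        have := hmax q ((h.mem_terminalChords_right hq').1 hq) (by omega)
        omega
  · rw [if_neg fun ht' => ht ((h.mem_terminalChords_right hf).1 ht'), if_neg ht]

-- Only the base chord of `S'` changes its factor: it is no longer the base chord, and gains the
-- label gap to the last chord of `F`. If `S'` is one chord, that chord stops being terminal and the
-- gained factor has index `1 - 1 = 0`.
open scoped Classical in
theorem monomialFactor_left {S S' F : Finset Chord} {r : Chord} (h : IsRootShare S S' F r)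
    {c : Chord} (hc : c ∈ S') : monomialFactor a dec S c = monomialFactor a dec S' c *
      if c = baseChord S' then a (dec c) (chordLabel S' c - 1) else 1 := by
  rw [monomialFactor, monomialFactor, h.baseChord_eq]
  by_cases hcr : c = r
  · subst hcr
    rw [if_neg h.root_notMem_terminalChords]
    by_cases ht : c ∈ terminalChords S'
    · have hb : c = baseChord S' := by
        rw [h.eq_singleton_of_root_mem ht, baseChord_singleton]
      rw [if_pos ht, if_pos hb, if_pos hb, one_mul, h.chordLabel_left_root]
    · have hb : c ≠ baseChord S' := fun hb => ht (hb ▸ (baseChord_spec h.conn_left.1).1)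
      rw [if_neg ht, if_neg hb, mul_one]
  have hcF : c ≠ baseChord F := fun hcF => h.disjoint c hc (hcF ▸ baseChord_mem h.conn_right.1)
  by_cases ht : c ∈ terminalChords S'
  · rw [if_pos ((h.mem_terminalChords_left hc hcr).2 ht), if_pos ht, if_neg hcF,
      h.chordLabel_left hc hcr]
    have hroot : ∀ q ∈ terminalChords S', q ≠ r := by
      rintro q hq rfl
      have := h.eq_singleton_of_root_mem hq
      rw [this, Finset.mem_singleton] at hc
      exact hcr hc
    by_cases hb : c = baseChord S'
    · rw [if_pos hb, if_pos hb, one_mul]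
      -- The last chord `p` of `F` has label `F.card + 1` in `S`, and `c` has label `chordLabel S' c
      -- + F.card`.
      obtain ⟨p, hp, hpl⟩ := exists_terminal_last h.diagram_right h.conn_right
      have hpF := (mem_terminalChords.1 hp).1
      rw [prevTerminalLabel_eq (S := S) ((h.mem_terminalChords_right hpF).2 hp),
        h.chordLabel_right hpF, hpl, add_comm F.card, Nat.add_sub_add_right]
      · rw [h.chordLabel_right hpF, h.chordLabel_left hc hcr, hpl]
        have h1 := chordLabel_pos S' c
        have h2 : chordLabel S' c ≠ 1 := fun h2 => hcr
          (chordLabel_injOn h.diagram_left h.conn_left hc (h2.trans h.chordLabel_left_root.symm))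
        omega
      · intro q hq hqc
        have hqr : q ≠ r := fun hqr => h.root_notMem_terminalChords (hqr ▸ hq)
        rw [h.chordLabel_left hc hcr] at hqc
        rw [h.chordLabel_right hpF]
        rcases (h.union q).1 (mem_terminalChords.1 hq).1 with hq' | hq'
        · rw [h.chordLabel_left hq' hqr] at hqc
          have := (baseChord_spec h.conn_left.1).2 q ((h.mem_terminalChords_left hq' hqr).1 hq)
          rw [← hb] at this
          omega
        · rw [h.chordLabel_right hq']
          have := chordLabel_le h.diagram_right h.conn_right hq'
          omega
    · rw [if_neg hb, if_neg hb, mul_one]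
      obtain ⟨p, hp, hpc, hmax⟩ := exists_prevTerminal h.diagram_left h.conn_left ht hb
      have hpS := (mem_terminalChords.1 hp).1
      have hpr := hroot p hp
      rw [prevTerminalLabel_eq hp hpc hmax,
        prevTerminalLabel_eq (S := S) ((h.mem_terminalChords_left hpS hpr).2 hp)
          (by rw [h.chordLabel_left hpS hpr, h.chordLabel_left hc hcr]; omega),
        h.chordLabel_left hpS hpr, Nat.add_sub_add_right]
      intro q hq hqc
      have hqr : q ≠ r := fun hqr => h.root_notMem_terminalChords (hqr ▸ hq)
      rw [h.chordLabel_left hc hcr] at hqc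
      rw [h.chordLabel_left hpS hpr]
      rcases (h.union q).1 (mem_terminalChords.1 hq).1 with hq' | hq'
      · rw [h.chordLabel_left hq' hqr] at hqc ⊢
        have := hmax q ((h.mem_terminalChords_left hq' hqr).1 hq) (by omega)
        omega
      · rw [h.chordLabel_right hq']
        have := chordLabel_le h.diagram_right h.conn_right hq'
        have := chordLabel_pos S' p
        omega
  · have hb : c ≠ baseChord S' := fun hb => ht (hb ▸ (baseChord_spec h.conn_left.1).1)
    rw [if_neg fun ht' => ht ((h.mem_terminalChords_left hc hcr).1 ht'), if_neg ht, if_neg hb,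
      mul_one]

theorem prod_monomialFactor {S S' F : Finset Chord} {r : Chord} (h : IsRootShare S S' F r) :
    ∏ c ∈ S, monomialFactor a dec S c = (∏ c ∈ F, monomialFactor a dec F c) *
      ((∏ c ∈ S', monomialFactor a dec S' c) *
        a (dec (baseChord S')) (chordLabel S' (baseChord S') - 1)) := by
  classical
  rw [Finset.prod_congr h.eq_union fun _ _ => rfl,
    Finset.prod_union (Finset.disjoint_left.2 h.disjoint), mul_comm,
    Finset.prod_congr rfl fun f hf => monomialFactor_right a dec h hf,
    Finset.prod_congr (s₁ := S') rfl fun f hf => monomialFactor_left a dec h hf,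
    Finset.prod_mul_distrib, Finset.prod_ite_eq', if_pos (baseChord_mem h.conn_left.1)]

theorem monomialFactor_singleton (c : Chord) : monomialFactor a dec {c} c = 1 := by
  rw [monomialFactor, terminalChords_singleton, baseChord_singleton,
    if_pos (Finset.mem_singleton_self c), if_pos rfl]

end Monomial

/-! ### Leaves of the insertion tree and the product of the weights. -/

namespace InsTree

/-- The chords at the leaves, from left to right. -/
def leaves : InsTree → List Chord
  | .leaf c => [c]
  | .node l r => l.leaves ++ r.leaves

/-- Relabelling of the leaves. -/
def map (g : Chord → Chord) : InsTree → InsTree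
  | .leaf c => .leaf (g c)
  | .node l r => .node (l.map g) (r.map g)

theorem numVertices_map (g : Chord → Chord) (T : InsTree) :
    (T.map g).numVertices = T.numVertices := by
  induction T with
  | leaf c => rfl
  | node l r hl hr => simp only [map, numVertices, hl, hr]

theorem map_insertAt (g : Chord → Chord) (T T' : InsTree) (k : ℕ) :
    (T.insertAt T' k).map g = (T.map g).insertAt (T'.map g) k := by
  induction T' generalizing k with
  | leaf c => rfl
  | node l r hl hr =>
    simp only [map, insertAt, numVertices_map]
    split_ifs
    · rfl
    · simp only [map, hl]
    · simp only [map, hr]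

theorem leaves_insertAt (T T' : InsTree) (k : ℕ) :
    (T.insertAt T' k).leaves.Perm (T.leaves ++ T'.leaves) := by
  induction T' generalizing k with
  | leaf c => rfl
  | node l r hl hr =>
    rw [insertAt]
    split_ifs
    · rfl
    · simp only [leaves]
      rw [← List.append_assoc]
      exact (hl _).append_right _
    · simp only [leaves]
      refine ((hr _).append_left l.leaves).trans ?_
      rw [← List.append_assoc, ← List.append_assoc]
      exact List.perm_append_comm.append_right _

theorem branchLeft_eq_zero {c : Chord} {T : InsTree} (h : c ∉ T.leaves) (j : ℕ) :
    T.branchLeft c j = 0 := by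
  induction T generalizing j with
  | leaf e =>
    rw [leaves, List.mem_singleton] at h
    exact if_neg (Ne.symm h)
  | node l r hl hr =>
    rw [leaves, List.mem_append, not_or] at h
    rw [branchLeft, hl h.1, hr h.2]

/-- `branchLeft` adds the contributions of both subtrees; as the leaves are distinct, only the
subtree that contains `c` contributes, and the product follows the recursion of `weight`. -/
theorem prod_branchLeft {R : Type*} [CommMonoid R] (w : ℕ → ℕ → R) (g : Chord → Chord)
    {T : InsTree} (h : T.leaves.Nodup) (j : ℕ) :
    ∏ c ∈ T.leaves.toFinset, w (g c).1 (T.branchLeft c j) = (T.map g).weight w j := by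
  induction T generalizing j with
  | leaf e => simp [leaves, map, weight, branchLeft]
  | node l r hl hr =>
    rw [leaves, List.nodup_append'] at h
    rw [leaves, List.toFinset_append, Finset.prod_union, map, weight, ← hl h.1, ← hr h.2.1]
    · congr 1
      · refine Finset.prod_congr rfl fun c hc => ?_
        rw [branchLeft, branchLeft_eq_zero (T := r) (h.2.2 (List.mem_toFinset.1 hc)), add_zero]
      · refine Finset.prod_congr rfl fun c hc => ?_
        rw [branchLeft, branchLeft_eq_zero (T := l)
          (fun hcl => h.2.2 hcl (List.mem_toFinset.1 hc)), zero_add]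
    · exact Finset.disjoint_left.2 fun c hc hc' =>
        h.2.2 (List.mem_toFinset.1 hc) (List.mem_toFinset.1 hc')

end InsTree

theorem insertionTree_singleton (c : Chord) : insertionTree {c} = .leaf c := by
  rw [insertionTree, dif_neg (by simp [Finset.not_nontrivial_singleton]), rootChord_singleton]

theorem leaves_insertionTree {S : Finset Chord} (hd : IsDiagram S) (hc : IsConn S) :
    (insertionTree S).leaves.Nodup ∧ (insertionTree S).leaves.toFinset = S := by
  refine isConn_induction (P := fun S => (insertionTree S).leaves.Nodup ∧
    (insertionTree S).leaves.toFinset = S) ?_ ?_ hd hc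
  · intro c _
    rw [insertionTree_singleton, InsTree.leaves]
    simp
  · rintro S S' F r h ⟨h1, h2⟩ ⟨h3, h4⟩
    rw [h.insertionTree_eq]
    have hp := InsTree.leaves_insertAt (insertionTree S') (insertionTree F) (insertionIndex S)
    constructor
    · rw [hp.nodup_iff, List.nodup_append']
      refine ⟨h1, h3, fun c hc hc' => h.disjoint c ?_ ?_⟩
      · rwa [← h2, List.mem_toFinset]
      · rwa [← h4, List.mem_toFinset]
    · rw [List.toFinset_eq_of_perm _ _ hp, List.toFinset_append, h2, h4, ← h.eq_union]

/-! ### The code of a diagram and the statistics it preserves. -/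

/-- The code of a connected diagram with decorations `dec`. -/
noncomputable def codeOf (dec : Chord → ℕ+) (S : Finset Chord) : ChordCode :=
  if h : S.Nontrivial then
    .ins (codeOf dec (S \ firstComponent S)) (codeOf dec (firstComponent S)) (insertionIndex S)
  else .single (dec (rootChord S))
termination_by S.card
decreasing_by
  · exact Finset.card_lt_card (Finset.sdiff_ssubset (firstComponent_ssubset h.nonempty).subset
      (firstComponent_nonempty h))
  · exact Finset.card_lt_card (firstComponent_ssubset h.nonempty)

theorem codeOf_singleton (dec : Chord → ℕ+) (c : Chord) : codeOf dec {c} = .single (dec c) := by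
  rw [codeOf, dif_neg (by simp [Finset.not_nontrivial_singleton]), rootChord_singleton]

theorem IsRootShare.codeOf_eq {S S' F : Finset Chord} {r : Chord} (h : IsRootShare S S' F r)
    (dec : Chord → ℕ+) :
    codeOf dec S = .ins (codeOf dec S') (codeOf dec F) (insertionIndex S) := by
  rw [codeOf, dif_pos h.nontrivial, h.firstComponent_eq, h.sdiff_eq]

section

variable (dec : Chord → ℕ+) {S : Finset Chord}

theorem size_codeOf (hd : IsDiagram S) (hc : IsConn S) : (codeOf dec S).size = S.card := by
  refine isConn_induction (P := fun S => (codeOf dec S).size = S.card) ?_ ?_ hd hc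
  · intro c _
    rw [codeOf_singleton, ChordCode.size, Finset.card_singleton]
  · intro S S' F r h h1 h2
    rw [h.codeOf_eq, ChordCode.size, h1, h2, h.card_eq]

theorem norm_codeOf (hd : IsDiagram S) (hc : IsConn S) :
    (codeOf dec S).norm = ∑ c ∈ S, (dec c : ℕ) := by
  refine isConn_induction (P := fun S => (codeOf dec S).norm = ∑ c ∈ S, (dec c : ℕ)) ?_ ?_ hd hc
  · intro c _
    rw [codeOf_singleton, ChordCode.norm, Finset.sum_singleton]
  · intro S S' F r h h1 h2
    rw [h.codeOf_eq, ChordCode.norm, h1, h2, Finset.sum_congr h.eq_union fun _ _ => rfl,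
      Finset.sum_union (Finset.disjoint_left.2 h.disjoint)]

theorem isValid_codeOf {D : Set ℕ+} (hd : IsDiagram S) (hc : IsConn S) :
    (codeOf dec S).IsValid D ↔ ∀ c ∈ S, dec c ∈ D := by
  refine isConn_induction (P := fun S => (codeOf dec S).IsValid D ↔ ∀ c ∈ S, dec c ∈ D)
    ?_ ?_ hd hc
  · intro c _
    rw [codeOf_singleton, ChordCode.IsValid]
    simp only [Finset.mem_singleton, forall_eq]
  · intro S S' F r h h1 h2
    rw [h.codeOf_eq, ChordCode.IsValid, h1, h2, size_codeOf dec h.diagram_right h.conn_right]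
    constructor
    · rintro ⟨h3, h4, -⟩ c hc
      rcases (h.union c).1 hc with hc | hc
      exacts [h3 c hc, h4 c hc]
    · exact fun h3 => ⟨fun c hc => h3 c (h.subset_left hc), fun c hc => h3 c (h.subset_right hc),
        h.insertionIndex_pos, h.insertionIndex_lt⟩

theorem base_codeOf (hd : IsDiagram S) (hc : IsConn S) :
    (codeOf dec S).baseIndex = chordLabel S (baseChord S) ∧
      (codeOf dec S).baseDec = dec (baseChord S) := by
  refine isConn_induction (P := fun S => (codeOf dec S).baseIndex = chordLabel S (baseChord S) ∧
      (codeOf dec S).baseDec = dec (baseChord S)) ?_ ?_ hd hc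
  · intro c _
    rw [codeOf_singleton, ChordCode.baseIndex, ChordCode.baseDec, baseChord_singleton,
      chordLabel_singleton]
    exact ⟨rfl, rfl⟩
  · intro S S' F r h _ h2
    rw [h.codeOf_eq, ChordCode.baseIndex, ChordCode.baseDec, h.chordLabel_baseChord, h2.1, h2.2,
      h.baseChord_eq]
    exact ⟨rfl, rfl⟩

theorem monomial_codeOf {R : Type*} [CommMonoid R] (a : ℕ → ℕ → R) (hd : IsDiagram S)
    (hc : IsConn S) :
    (codeOf dec S).monomial a = ∏ c ∈ S, monomialFactor a dec S c := by
  refine isConn_induction (P := fun S => (codeOf dec S).monomial a =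
    ∏ c ∈ S, monomialFactor a dec S c) ?_ ?_ hd hc
  · intro c _
    rw [codeOf_singleton, ChordCode.monomial, Finset.prod_singleton, monomialFactor_singleton]
  · intro S S' F r h h1 h2
    obtain ⟨h3, h4⟩ := base_codeOf dec h.diagram_left h.conn_left
    rw [h.codeOf_eq, ChordCode.monomial, h1, h2, h3, h4, prod_monomialFactor a dec h]

theorem tree_codeOf (hd : IsDiagram S) (hc : IsConn S) :
    (codeOf dec S).tree = (insertionTree S).map fun c => ((dec c : ℕ), 0) := by
  refine isConn_induction (P := fun S => (codeOf dec S).tree =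
    (insertionTree S).map fun c => ((dec c : ℕ), 0)) ?_ ?_ hd hc
  · intro c _
    rw [codeOf_singleton, insertionTree_singleton]
    rfl
  · intro S S' F r h h1 h2
    rw [h.codeOf_eq, ChordCode.tree, h1, h2, h.insertionTree_eq, InsTree.map_insertAt]

theorem weight_codeOf {R : Type*} [CommMonoid R] (w : ℕ → ℕ → R) (hd : IsDiagram S)
    (hc : IsConn S) :
    (codeOf dec S).tree.weight w 0 = ∏ c ∈ S, w (dec c) (branchLeft S c) := by
  obtain ⟨h1, h2⟩ := leaves_insertionTree hd hc
  rw [tree_codeOf dec hd hc, ← InsTree.prod_branchLeft w _ h1, h2]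
  rfl

end

/-! ### Gluing: every valid code comes from a diagram. -/

/-- The image of a set of chords under a map of the endpoints. -/
def mapChords (φ : ℕ → ℕ) (S : Finset Chord) : Finset Chord := S.image (Prod.map φ φ)

theorem mem_mapChords {φ : ℕ → ℕ} {S : Finset Chord} {c : Chord} :
    c ∈ mapChords φ S ↔ ∃ e ∈ S, Prod.map φ φ e = c := Finset.mem_image

theorem map_mem_mapChords (φ : ℕ → ℕ) {S : Finset Chord} {c : Chord} (hc : c ∈ S) :
    Prod.map φ φ c ∈ mapChords φ S := Finset.mem_image_of_mem _ hc

theorem endpoints_mapChords (φ : ℕ → ℕ) (S : Finset Chord) :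
    endpoints (mapChords φ S) = (endpoints S).image φ := by
  ext x
  simp only [mem_endpoints, mem_mapChords, Finset.mem_image]
  constructor
  · rintro ⟨_, ⟨c, hc, rfl⟩, h | h⟩
    exacts [⟨c.1, ⟨c, hc, Or.inl rfl⟩, h⟩, ⟨c.2, ⟨c, hc, Or.inr rfl⟩, h⟩]
  · rintro ⟨y, ⟨c, hc, rfl | rfl⟩, h⟩
    exacts [⟨_, ⟨c, hc, rfl⟩, Or.inl h⟩, ⟨_, ⟨c, hc, rfl⟩, Or.inr h⟩]

section StrictMono

variable {φ : ℕ → ℕ} {S S' F : Finset Chord} {r : Chord}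

theorem StrictMono.crosses_map_iff (hφ : StrictMono φ) {c e : Chord} :
    Chord.Crosses (Prod.map φ φ c) (Prod.map φ φ e) ↔ c.Crosses e := by
  simp only [Chord.Crosses, Prod.map_fst, Prod.map_snd, hφ.lt_iff_lt]

theorem StrictMono.prodMap_injective (hφ : StrictMono φ) : Function.Injective (Prod.map φ φ) :=
  hφ.injective.prodMap hφ.injective

theorem IsDiagram.mapChords (h : IsDiagram S) (hφ : StrictMono φ) :
    IsDiagram (mapChords φ S) := by
  constructor
  · intro c hc
    rw [mem_mapChords] at hc
    obtain ⟨c, hc, rfl⟩ := hc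
    exact hφ (h.lt c hc)
  · intro c hc e he hne
    rw [mem_mapChords] at hc
    obtain ⟨c, hc, rfl⟩ := hc
    rw [mem_mapChords] at he
    obtain ⟨e, he, rfl⟩ := he
    obtain ⟨h1, h2, h3, h4⟩ := h.disjoint c hc e he fun hce => hne (hce ▸ rfl)
    exact ⟨hφ.injective.ne h1, hφ.injective.ne h2, hφ.injective.ne h3, hφ.injective.ne h4⟩

theorem IsConn.mapChords (h : IsConn S) (hφ : StrictMono φ) : IsConn (mapChords φ S) := by
  classical
  refine ⟨h.1.image _, fun A hA ⟨x, hx⟩ hcl => hA.antisymm fun y hy => ?_⟩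
  obtain ⟨c, hc, rfl⟩ := mem_mapChords.1 (hA hx)
  obtain ⟨e, he, rfl⟩ := mem_mapChords.1 hy
  have := h.2 (S.filter fun d => Prod.map φ φ d ∈ A) (Finset.filter_subset _ _)
    ⟨c, Finset.mem_filter.2 ⟨hc, hx⟩⟩ fun a ha b hb hab => by
      rw [Finset.mem_filter] at ha ⊢
      exact ⟨hb, hcl _ ha.2 _ (map_mem_mapChords φ hb) (hφ.crosses_map_iff.2 hab)⟩
  exact (Finset.mem_filter.1 (this.symm.subset he)).2

theorem IsDiagram.rootChord_mapChords (h : IsDiagram S) (hS : S.Nonempty) (hφ : StrictMono φ) :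
    rootChord (_root_.mapChords φ S) = Prod.map φ φ (rootChord S) := by
  refine (h.mapChords hφ).rootChord_eq (map_mem_mapChords φ (rootChord_mem hS)) fun c hc => ?_
  rw [mem_mapChords] at hc
  obtain ⟨c, hc, rfl⟩ := hc
  exact hφ.monotone (rootChord_fst_le hc)

theorem IsRootShare.mapChords (h : IsRootShare S S' F r) (hφ : StrictMono φ) :
    IsRootShare (mapChords φ S) (mapChords φ S') (mapChords φ F) (Prod.map φ φ r) := by
  refine ⟨fun c => ?_, ?_, h.isDiagram.mapChords hφ, h.conn_left.mapChords hφ,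
    h.conn_right.mapChords hφ, map_mem_mapChords φ h.root_mem, ?_, ?_, ?_, ?_⟩
  · simp only [mem_mapChords, h.union, or_and_right, exists_or]
  · intro c hc hcF
    rw [mem_mapChords] at hc
    obtain ⟨c, hc, rfl⟩ := hc
    obtain ⟨e, he, hce⟩ := mem_mapChords.1 hcF
    exact h.disjoint c hc (hφ.prodMap_injective hce ▸ he)
  · intro c hc hcr
    rw [mem_mapChords] at hc
    obtain ⟨c, hc, rfl⟩ := hc
    exact hφ (h.root_lt c hc fun h => hcr (h ▸ rfl))
  · intro c hc hcr
    rw [mem_mapChords] at hc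
    obtain ⟨c, hc, rfl⟩ := hc
    rw [h.diagram_right.rootChord_mapChords h.conn_right.1 hφ]
    exact hφ (h.first c hc fun h => hcr (h ▸ rfl))
  · intro c hc hcr f hf hcf
    rw [mem_mapChords] at hc
    obtain ⟨c, hc, rfl⟩ := hc
    rw [mem_mapChords] at hf
    obtain ⟨f, hf, rfl⟩ := hf
    exact h.not_crosses c hc (fun h => hcr (h ▸ rfl)) f hf (hφ.crosses_map_iff.1 hcf)
  · obtain ⟨f, hf, hrf⟩ := h.crosses
    exact ⟨_, map_mem_mapChords φ hf, hφ.crosses_map_iff.2 hrf⟩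

theorem IsRootShare.insertionIndex_mapChords (h : IsRootShare S S' F r) (hφ : StrictMono φ) :
    insertionIndex (_root_.mapChords φ S) = insertionIndex S := by
  rw [(h.mapChords hφ).insertionIndex_eq, h.insertionIndex_eq, endpoints_mapChords,
    Finset.filter_image, Finset.card_image_of_injective _ hφ.injective]
  simp only [Prod.map_snd, hφ.lt_iff_lt]

/-- The code depends only on the relative order of the endpoints and on the decorations of the
chords of `S`. -/
theorem codeOf_mapChords (hd : IsDiagram S) (hc : IsConn S) (hφ : StrictMono φ)
    {dec dec' : Chord → ℕ+} (hdec : ∀ c ∈ S, dec' (Prod.map φ φ c) = dec c) :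
    codeOf dec' (mapChords φ S) = codeOf dec S := by
  revert hdec
  refine isConn_induction (P := fun S => (∀ c ∈ S, dec' (Prod.map φ φ c) = dec c) →
    codeOf dec' (mapChords φ S) = codeOf dec S) ?_ ?_ hd hc
  · intro c _ hdec
    rw [mapChords, Finset.image_singleton, codeOf_singleton, codeOf_singleton,
      hdec c (Finset.mem_singleton_self c)]
  · intro S S' F r h h1 h2 hdec
    rw [(h.mapChords hφ).codeOf_eq, h.codeOf_eq, h1 fun c hc => hdec c (h.subset_left hc),
      h2 fun c hc => hdec c (h.subset_right hc), h.insertionIndex_mapChords hφ]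

end StrictMono

/-- The set of endpoints consists of the first natural numbers. -/
def IsStandard (S : Finset Chord) : Prop := endpoints S = Finset.range (2 * S.card)

theorem IsStandard.rootChord_fst {S : Finset Chord} (h : IsStandard S) (hd : IsDiagram S)
    (hS : S.Nonempty) : (rootChord S).1 = 0 := by
  have h0 : 0 ∈ endpoints S := by
    rw [h, Finset.mem_range]
    have := hS.card_pos
    omega
  obtain ⟨c, hc, h1 | h1⟩ := mem_endpoints.1 h0
  · have := rootChord_fst_le hc
    omega
  · have := hd.lt c hc
    omega

theorem IsStandard.lt {S : Finset Chord} (h : IsStandard S) {c : Chord} (hc : c ∈ S) :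
    c.1 < 2 * S.card ∧ c.2 < 2 * S.card := by
  have h1 := fst_mem_endpoints hc
  have h2 := snd_mem_endpoints hc
  rw [h, Finset.mem_range] at h1 h2
  exact ⟨h1, h2⟩

/-- In a connected diagram, some chord straddles any given interval between endpoints. -/
theorem IsConn.exists_straddle {S : Finset Chord} (h : IsConn S) (hd : IsDiagram S)
    (hs : IsStandard S) {k : ℕ} (hk : 1 ≤ k) (hk' : k < 2 * S.card) :
    ∃ f ∈ S, f.1 < k ∧ k ≤ f.2 := by
  classical
  -- Otherwise the chords that end before `k` form a closed set containing the root chord, hence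
  -- everything, although position `k` is an endpoint.
  by_contra! hno
  have hr := hs.rootChord_fst hd h.1
  have := h.2 (S.filter fun f => f.2 < k) (Finset.filter_subset _ _)
    ⟨rootChord S, Finset.mem_filter.2 ⟨rootChord_mem h.1, hno _ (rootChord_mem h.1) (by omega)⟩⟩
    fun c hc e he hce => by
      rw [Finset.mem_filter] at hc ⊢
      refine ⟨he, hno e he ?_⟩
      unfold Chord.Crosses at hce
      omega
  have hke : k ∈ endpoints S := by
    rw [hs, Finset.mem_range]
    exact hk'
  obtain ⟨c, hc, hck⟩ := mem_endpoints.1 hke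
  have h1 := (Finset.mem_filter.1 (this.symm.subset hc)).2
  have h2 := hd.lt c hc
  omega

/-- The positions of the left part of `S' ∘ₖ F`. -/
def leftShift (k i : ℕ) : ℕ := if i = 0 then 0 else i + k

/-- The positions of the right part of `S' ∘ₖ F`, where `S'` has `n` chords. -/
def rightShift (k n j : ℕ) : ℕ := if j < k then j + 1 else j + 2 * n

theorem strictMono_leftShift (k : ℕ) : StrictMono (leftShift k) := by
  intro i j hij
  unfold leftShift
  split_ifs <;> omega

theorem strictMono_rightShift (k : ℕ) {n : ℕ} (hn : 1 ≤ n) : StrictMono (rightShift k n) := by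
  intro i j hij
  unfold rightShift
  split_ifs <;> omega

/-- Positions start at 0. The first endpoint of `S` stays at 0, the first `k` endpoints of `F` take
1 to `k`, then come the other endpoints of `S`, then the rest of `F`. A chord of `F` straddling the
gap is crossed by the root chord of `S`. -/
theorem isRootShare_shift {S F : Finset Chord} (hS : IsDiagram S) (hSc : IsConn S)
    (hSs : IsStandard S) (hF : IsDiagram F) (hFc : IsConn F) (hFs : IsStandard F) {k : ℕ}
    (hk : 1 ≤ k) (hk' : k < 2 * F.card) :
    IsRootShare (mapChords (leftShift k) S ∪ mapChords (rightShift k S.card) F)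
      (mapChords (leftShift k) S) (mapChords (rightShift k S.card) F)
      (Prod.map (leftShift k) (leftShift k) (rootChord S)) := by
  have hn : 1 ≤ S.card := hSc.1.card_pos
  have hα := strictMono_leftShift k
  have hβ := strictMono_rightShift k hn
  have hne : ∀ i j, i < 2 * S.card → leftShift k i ≠ rightShift k S.card j := by
    intro i j hi
    unfold leftShift rightShift
    split_ifs <;> omega
  have hr0 := hSs.rootChord_fst hS hSc.1
  have hr0' : leftShift k (rootChord S).1 = 0 := by rw [hr0]; rfl
  have hcross : ∀ c ∈ S, ∀ e ∈ F, ∀ c' e' : Chord,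
      c' = Prod.map (leftShift k) (leftShift k) c →
      e' = Prod.map (rightShift k S.card) (rightShift k S.card) e →
      c'.1 ≠ e'.1 ∧ c'.1 ≠ e'.2 ∧ c'.2 ≠ e'.1 ∧ c'.2 ≠ e'.2 := by
    rintro c hc e he _ _ rfl rfl
    have := hSs.lt hc
    exact ⟨hne _ _ this.1, hne _ _ this.1, hne _ _ this.2, hne _ _ this.2⟩
  have hpos : ∀ c ∈ S, c ≠ rootChord S → 0 < c.1 := fun c hc hcr => by
    have := hS.rootChord_lt hc hcr
    omega
  refine ⟨fun c => Finset.mem_union, ?_, ⟨?_, ?_⟩, hSc.mapChords hα, hFc.mapChords hβ,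
    map_mem_mapChords _ (rootChord_mem hSc.1), ?_, ?_, ?_, ?_⟩
  · intro c hc hc'
    obtain ⟨e, he, hec⟩ := mem_mapChords.1 hc
    obtain ⟨f, hf, hfc⟩ := mem_mapChords.1 hc'
    exact (hcross e he f hf c c hec.symm hfc.symm).1 rfl
  · intro c hc
    rcases Finset.mem_union.1 hc with hc | hc
    · exact (hS.mapChords hα).lt c hc
    · exact (hF.mapChords hβ).lt c hc
  · intro c hc e he hce
    rcases Finset.mem_union.1 hc with hc | hc <;> rcases Finset.mem_union.1 he with he | he
    · exact (hS.mapChords hα).disjoint c hc e he hce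
    · obtain ⟨c', hc', rfl⟩ := mem_mapChords.1 hc
      obtain ⟨e', he', rfl⟩ := mem_mapChords.1 he
      exact hcross c' hc' e' he' _ _ rfl rfl
    · obtain ⟨c', hc', rfl⟩ := mem_mapChords.1 hc
      obtain ⟨e', he', rfl⟩ := mem_mapChords.1 he
      obtain ⟨h1, h2, h3, h4⟩ := hcross e' he' c' hc' _ _ rfl rfl
      exact ⟨h1.symm, h3.symm, h2.symm, h4.symm⟩
    · exact (hF.mapChords hβ).disjoint c hc e he hce
  · intro c hc hcr
    rw [Prod.map_fst, hr0']
    rw [Finset.mem_union] at hc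
    rcases hc with hc | hc
    · rw [mem_mapChords] at hc
      obtain ⟨c, hc, rfl⟩ := hc
      have := hpos c hc fun h => hcr (h ▸ rfl)
      rw [Prod.map_fst, leftShift, if_neg this.ne']
      omega
    · rw [mem_mapChords] at hc
      obtain ⟨c, hc, rfl⟩ := hc
      rw [Prod.map_fst, rightShift]
      split_ifs <;> omega
  · intro c hc hcr
    rw [mem_mapChords] at hc
    obtain ⟨c, hc, rfl⟩ := hc
    have := hpos c hc fun h => hcr (h ▸ rfl)
    rw [hF.rootChord_mapChords hFc.1 hβ, Prod.map_fst, Prod.map_fst, hFs.rootChord_fst hF hFc.1,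
      leftShift, rightShift, if_neg this.ne', if_pos (by omega)]
    omega
  · intro c hc hcr f hf hcf
    rw [mem_mapChords] at hc
    obtain ⟨c, hc, rfl⟩ := hc
    rw [mem_mapChords] at hf
    obtain ⟨f, hf, rfl⟩ := hf
    have h1 := hpos c hc fun h => hcr (h ▸ rfl)
    have h2 := hSs.lt hc
    have h3 := hS.lt c hc
    simp only [Chord.Crosses, Prod.map_fst, Prod.map_snd, leftShift, rightShift] at hcf
    have h4 := hF.lt f hf
    rw [if_neg h1.ne', if_neg (show c.2 ≠ 0 by omega)] at hcf
    split_ifs at hcf <;> omega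
  · obtain ⟨f, hf, hf1, hf2⟩ := hFc.exists_straddle hF hFs hk hk'
    refine ⟨_, map_mem_mapChords _ hf, Or.inl ?_⟩
    have h2 := hSs.lt (rootChord_mem hSc.1)
    have h3 := hS.lt _ (rootChord_mem hSc.1)
    simp only [Prod.map_fst, Prod.map_snd, leftShift, rightShift]
    rw [if_pos hr0, if_neg (show (rootChord S).2 ≠ 0 by omega), if_pos hf1,
      if_neg (show ¬ f.2 < k by omega)]
    omega

theorem exists_codeOf_eq {D : Set ℕ+} {C : ChordCode} (hC : C.IsValid D) :
    ∃ (S : Finset Chord) (dec : Chord → ℕ+), IsDiagram S ∧ IsConn S ∧ IsStandard S ∧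
      codeOf dec S = C := by
  classical
  induction C with
  | single d =>
    refine ⟨{(0, 1)}, fun _ => d, ⟨?_, ?_⟩, isConn_singleton _, ?_, codeOf_singleton _ _⟩
    · simp
    · intro c hc e he hce
      rw [Finset.mem_singleton] at hc he
      exact absurd (hc.trans he.symm) hce
    · rfl
  | ins A B k hA hB =>
    obtain ⟨hvA, hvB, hk, hk'⟩ := hC
    obtain ⟨S, dS, hS, hSc, hSs, rfl⟩ := hA hvA
    obtain ⟨F, dF, hF, hFc, hFs, rfl⟩ := hB hvB
    rw [size_codeOf dF hF hFc] at hk'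
    have h := isRootShare_shift hS hSc hSs hF hFc hFs hk hk'
    have hn : 1 ≤ S.card := hSc.1.card_pos
    have hα := strictMono_leftShift k
    have hβ := strictMono_rightShift k hn
    have hαi := Function.leftInverse_invFun hα.prodMap_injective
    have hβi := Function.leftInverse_invFun hβ.prodMap_injective
    -- Each chord takes its decoration back from the part it comes from.
    let dec : Chord → ℕ+ := fun c => if c ∈ mapChords (leftShift k) S then
        dS (Function.invFun (Prod.map (leftShift k) (leftShift k)) c)
      else dF (Function.invFun (Prod.map (rightShift k S.card) (rightShift k S.card)) c)
    refine ⟨_, dec, h.isDiagram, h.isConn, ?_, ?_⟩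
    · refine Finset.eq_of_subset_of_card_le (fun x hx => ?_) ?_
      · rw [h.card_eq, Finset.mem_range, mapChords, mapChords,
          Finset.card_image_of_injective _ hα.prodMap_injective,
          Finset.card_image_of_injective _ hβ.prodMap_injective]
        rw [endpoints_union, endpoints_mapChords, endpoints_mapChords, hSs, hFs,
          Finset.mem_union, Finset.mem_image, Finset.mem_image] at hx
        rcases hx with ⟨i, hi, rfl⟩ | ⟨i, hi, rfl⟩
        · rw [Finset.mem_range] at hi
          unfold leftShift
          split_ifs <;> omega
        · rw [Finset.mem_range] at hi
          unfold rightShift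
          split_ifs <;> omega
      · rw [Finset.card_range, h.isDiagram.card_endpoints]
    · rw [h.codeOf_eq, codeOf_mapChords hS hSc hα, codeOf_mapChords hF hFc hβ]
      · congr 1
        have h2 := hSs.lt (rootChord_mem hSc.1)
        have h3 := hS.lt _ (rootChord_mem hSc.1)
        rw [h.insertionIndex_eq, endpoints_mapChords, Finset.filter_image,
          Finset.card_image_of_injective _ hβ.injective, hFs]
        -- The root chord of `S` ends at a position between 1 and `2 * S.card - 1`, so after the
        -- shift exactly the first `k` endpoints of `F` precede its end.
        have : ∀ j, rightShift k S.card j < (Prod.map (leftShift k) (leftShift k)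
            (rootChord S)).2 ↔ j < k := by
          intro j
          simp only [Prod.map_snd, leftShift, rightShift]
          split_ifs <;> omega
        simp only [this]
        rw [show (Finset.range (2 * F.card)).filter (· < k) = Finset.range k by
          ext j
          simp only [Finset.mem_filter, Finset.mem_range]
          omega, Finset.card_range]
      · intro c hc
        have hc' : Prod.map (rightShift k S.card) (rightShift k S.card) c ∉
            mapChords (leftShift k) S :=
          fun h' => h.disjoint _ h' (map_mem_mapChords _ hc)
        simp only [dec, if_neg hc']
        rw [hβi c]
      · intro c hc
        simp only [dec, if_pos (map_mem_mapChords (leftShift k) hc)]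
        rw [hαi c]

/-! ### Rigidity: a diagram in standard position is determined by its code. -/

/-- A strictly increasing map that preserves the number of elements below given thresholds
respects these thresholds. -/
theorem StrictMonoOn.lt_iff_of_card_eq {φ : ℕ → ℕ} {E : Finset ℕ} (hφ : StrictMonoOn φ E)
    {t u : ℕ} (h : (E.filter (· < t)).card = ((E.image φ).filter (· < u)).card) {p : ℕ}
    (hp : p ∈ E) : p < t ↔ φ p < u := by
  rw [Finset.filter_image, Finset.card_image_of_injOn
    (hφ.injOn.mono fun x hx => (Finset.mem_filter.1 hx).1)] at h
  constructor <;> intro hlt <;> by_contra hge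
  -- If `p < t` but `u ≤ φ p`, the elements with image below `u` all lie below `p`; they form a
  -- subset of those below `t` that misses `p`, contradicting the equal counts.
  · refine (Finset.card_lt_card (Finset.ssubset_iff_subset_ne.2 ⟨fun q hq => ?_, ?_⟩)).ne' h
    · rw [Finset.mem_filter] at hq ⊢
      have := (hφ.lt_iff_lt hq.1 hp).1 (by omega)
      exact ⟨hq.1, by omega⟩
    · intro heq
      exact hge (Finset.mem_filter.1 (heq.symm.subset (Finset.mem_filter.2 ⟨hp, hlt⟩))).2
  · refine (Finset.card_lt_card (Finset.ssubset_iff_subset_ne.2 ⟨fun q hq => ?_, ?_⟩)).ne h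
    · rw [Finset.mem_filter] at hq ⊢
      have := (hφ.lt_iff_lt hq.1 hp).2 (by omega)
      exact ⟨hq.1, by omega⟩
    · intro heq
      exact hge (Finset.mem_filter.1 (heq.symm.subset (Finset.mem_filter.2 ⟨hp, hlt⟩))).2

theorem StrictMonoOn.eq_self_of_image_range {φ : ℕ → ℕ} {N : ℕ}
    (hφ : StrictMonoOn φ (Finset.range N)) (h : (Finset.range N).image φ = Finset.range N) {x : ℕ}
    (hx : x ∈ Finset.range N) : φ x = x := by
  have hr : ∀ y ∈ Finset.range N, ((Finset.range N).filter (· < y)).card = y := by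
    intro y hy
    rw [Finset.mem_range] at hy
    rw [show (Finset.range N).filter (· < y) = Finset.range y by
      ext j
      simp only [Finset.mem_filter, Finset.mem_range]
      omega, Finset.card_range]
  have h1 := hr _ (h.subset (Finset.mem_image_of_mem φ hx))
  have h2 : ((Finset.range N).image φ).filter (· < φ x) =
      ((Finset.range N).filter (· < x)).image φ := by
    rw [Finset.filter_image]
    congr 1
    exact Finset.filter_congr fun y hy => hφ.lt_iff_lt hy hx
  rw [h] at h2
  rw [← h1, h2, Finset.card_image_of_injOn
    (hφ.injOn.mono fun y hy => (Finset.mem_filter.1 hy).1), hr x hx]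

namespace IsRootShare

variable {S S' F : Finset Chord} {r : Chord}

/-- All endpoints of `S'` but the first lie in one gap of `F`, so `r.2` can stand for any of them
when comparing with endpoints of `F`. -/
theorem lt_endpoint_iff (h : IsRootShare S S' F r) {p y : ℕ} (hp : p ∈ endpoints F)
    (hy : y ∈ endpoints S') (hyr : y ≠ r.1) : p < y ↔ p < r.2 := by
  obtain ⟨h1, h2⟩ := h.lt_iff hp
  obtain ⟨f, hf, hfp⟩ := mem_endpoints.1 hp
  obtain ⟨c, hc, hcy⟩ := mem_endpoints.1 hy
  have hne : ∀ c ∈ S', c.1 ≠ p ∧ c.2 ≠ p := by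
    intro c hc
    obtain ⟨h3, h4, h5, h6⟩ := h.isDiagram.disjoint c (h.subset_left hc) f (h.subset_right hf)
      fun hcf => h.disjoint c hc (hcf ▸ hf)
    rcases hfp with rfl | rfl
    exacts [⟨h3, h5⟩, ⟨h4, h6⟩]
  have h3 := hne c hc
  have h4 := hne r h.root_mem
  have h5 := h1 c hc
  rcases hcy with rfl | rfl
  · have h6 := h2 c hc fun hcr => hyr (hcr ▸ rfl)
    omega
  · omega

theorem root_lt_endpoint (h : IsRootShare S S' F r) {p : ℕ} (hp : p ∈ endpoints F) :
    r.1 < p := by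
  obtain ⟨f, hf, hfp⟩ := mem_endpoints.1 hp
  have h1 := h.root_lt f (h.subset_right hf) (h.ne_root hf)
  have h2 := h.diagram_right.lt f hf
  omega

theorem endpoint_ne (h : IsRootShare S S' F r) {p y : ℕ} (hp : p ∈ endpoints F)
    (hy : y ∈ endpoints S') : p ≠ y := by
  obtain ⟨f, hf, hfp⟩ := mem_endpoints.1 hp
  obtain ⟨c, hc, hcy⟩ := mem_endpoints.1 hy
  obtain ⟨h3, h4, h5, h6⟩ := h.isDiagram.disjoint c (h.subset_left hc) f (h.subset_right hf)
      fun hcf => h.disjoint c hc (hcf ▸ hf)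
  omega

end IsRootShare

/-- Connected diagrams with the same code are isomorphic. -/
theorem exists_mapChords_eq {dec dec' : Chord → ℕ+} {S T : Finset Chord} (hS : IsDiagram S)
    (hSc : IsConn S) (hT : IsDiagram T) (hTc : IsConn T) (h : codeOf dec S = codeOf dec' T) :
    ∃ φ : ℕ → ℕ, StrictMonoOn φ (endpoints S) ∧ mapChords φ S = T ∧
      ∀ c ∈ S, dec' (Prod.map φ φ c) = dec c := by
  classical
  revert T
  refine fun {T} => isConn_induction (P := fun S => ∀ T, IsDiagram T → IsConn T →
    codeOf dec S = codeOf dec' T → ∃ φ : ℕ → ℕ, StrictMonoOn φ (endpoints S) ∧ mapChords φ S = T ∧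
      ∀ c ∈ S, dec' (Prod.map φ φ c) = dec c) ?_ ?_ hS hSc T
  · intro c hc T hT hTc h
    rw [codeOf_singleton] at h
    rcases hTc.1.exists_eq_singleton_or_nontrivial with ⟨e, rfl⟩ | hnt
    · rw [codeOf_singleton, ChordCode.single.injEq] at h
      have hce : c.1 ≠ c.2 := hc.ne
      have he := hT.lt e (Finset.mem_singleton_self e)
      have hmap : Prod.map (fun x => if x = c.1 then e.1 else e.2)
          (fun x => if x = c.1 then e.1 else e.2) c = e := by
        ext
        · simp
        · simp [hce.symm]
      refine ⟨fun x => if x = c.1 then e.1 else e.2, ?_, ?_, ?_⟩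
      · intro x hx y hy hxy
        rw [SetLike.mem_coe, mem_endpoints] at hx hy
        obtain ⟨x', hx', hx⟩ := hx
        obtain ⟨y', hy', hy⟩ := hy
        rw [Finset.mem_singleton] at hx' hy'
        rw [hx'] at hx
        rw [hy'] at hy
        have h1 : x = c.1 := by omega
        have h2 : y ≠ c.1 := by omega
        simp only [if_pos h1, if_neg h2]
        exact he
      · rw [mapChords, Finset.image_singleton, hmap]
      · intro c' hc'
        rw [Finset.mem_singleton] at hc'
        rw [hc', hmap, h]
    · rw [(isRootShare_firstComponent hT hTc hnt).codeOf_eq] at h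
      simp at h
  · intro S S' F r hr hS' hF T hT hTc h
    rw [hr.codeOf_eq] at h
    rcases hTc.1.exists_eq_singleton_or_nontrivial with ⟨e, rfl⟩ | hnt
    · rw [codeOf_singleton] at h
      simp at h
    obtain ⟨T', G, q, hq⟩ : ∃ T' G q, IsRootShare T T' G q :=
      ⟨_, _, _, isRootShare_firstComponent hT hTc hnt⟩
    rw [hq.codeOf_eq, ChordCode.ins.injEq] at h
    obtain ⟨h1, h2, h3⟩ := h
    obtain ⟨α, hα, hα', hαd⟩ := hS' T' hq.diagram_left hq.conn_left h1
    obtain ⟨β, hβ, hβ', hβd⟩ := hF G hq.diagram_right hq.conn_right h2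
    have hαm : ∀ x ∈ endpoints S', α x ∈ endpoints T' := fun x hx => by
      rw [← hα', endpoints_mapChords]
      exact Finset.mem_image_of_mem α hx
    have hβm : ∀ x ∈ endpoints F, β x ∈ endpoints G := fun x hx => by
      rw [← hβ', endpoints_mapChords]
      exact Finset.mem_image_of_mem β hx
    have hroot : Prod.map α α r = q := by
      have hm : Prod.map α α r ∈ T' := hα' ▸ map_mem_mapChords α hr.root_mem
      rw [← hq.rootChord_left]
      refine (hq.diagram_left.rootChord_eq hm fun c hc => ?_).symm
      rw [← hα', mem_mapChords] at hc
      obtain ⟨c, hc, rfl⟩ := hc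
      refine hα.monotoneOn (fst_mem_endpoints hr.root_mem) (fst_mem_endpoints hc) ?_
      rw [← hr.rootChord_left]
      exact rootChord_fst_le hc
    -- Equal insertion indices mean that the root chords end in the same gap of the right parts.
    have hrank : ∀ p ∈ endpoints F, p < r.2 ↔ β p < q.2 := fun p hp => by
      refine hβ.lt_iff_of_card_eq ?_ hp
      rw [← endpoints_mapChords, hβ', ← hr.insertionIndex_eq, ← hq.insertionIndex_eq, h3]
    -- With this gap fixed, the order between the two parts is determined, so `α` and `β` glue to an
    -- increasing map.
    have hcmp : ∀ p ∈ endpoints F, ∀ y ∈ endpoints S', p < y ↔ β p < α y := by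
      intro p hp y hy
      by_cases hyr : y = r.1
      · subst hyr
        have h4 := hr.root_lt_endpoint hp
        have h5 := hq.root_lt_endpoint (hβm p hp)
        rw [← hroot, Prod.map_fst] at h5
        omega
      · rw [hr.lt_endpoint_iff hp hy hyr, hrank p hp,
          hq.lt_endpoint_iff (hβm p hp) (hαm y hy)]
        intro hyq
        rw [← hroot, Prod.map_fst] at hyq
        exact hyr (hα.injOn hy (fst_mem_endpoints hr.root_mem) hyq)
    let φ : ℕ → ℕ := fun x => if x ∈ endpoints F then β x else α x
    have hφF : ∀ x ∈ endpoints F, φ x = β x := fun x hx => if_pos hx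
    have hφS : ∀ x ∈ endpoints S', φ x = α x := fun x hx =>
      if_neg fun hx' => hr.endpoint_ne hx' hx rfl
    have hφFc : ∀ c ∈ F, Prod.map φ φ c = Prod.map β β c := fun c hc =>
      Prod.ext (hφF _ (fst_mem_endpoints hc)) (hφF _ (snd_mem_endpoints hc))
    have hφSc : ∀ c ∈ S', Prod.map φ φ c = Prod.map α α c := fun c hc =>
      Prod.ext (hφS _ (fst_mem_endpoints hc)) (hφS _ (snd_mem_endpoints hc))
    refine ⟨φ, ?_, ?_, ?_⟩
    · intro x hx y hy hxy
      rw [hr.eq_union, endpoints_union, Finset.coe_union, Set.mem_union] at hx hy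
      rcases hx with hx | hx <;> rcases hy with hy | hy
      · rw [hφS x hx, hφS y hy]
        exact hα hx hy hxy
      · rw [hφS x hx, hφF y hy]
        have h4 := hcmp y hy x hx
        have h5 := hq.endpoint_ne (hβm y hy) (hαm x hx)
        omega
      · rw [hφF x hx, hφS y hy]
        exact (hcmp x hx y hy).1 hxy
      · rw [hφF x hx, hφF y hy]
        exact hβ hx hy hxy
    · rw [hr.eq_union, hq.eq_union, mapChords, Finset.image_union, ← hα', ← hβ', mapChords,
        mapChords, Finset.image_congr hφSc, Finset.image_congr hφFc]
    · intro c hc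
      rcases (hr.union c).1 hc with hc | hc
      · rw [hφSc c hc, hαd c hc]
      · rw [hφFc c hc, hβd c hc]

/-- A connected diagram in standard position is determined by its code. -/
theorem eq_of_codeOf_eq {dec dec' : Chord → ℕ+} {S T : Finset Chord} (hS : IsDiagram S)
    (hSc : IsConn S) (hSs : IsStandard S) (hT : IsDiagram T) (hTc : IsConn T) (hTs : IsStandard T)
    (h : codeOf dec S = codeOf dec' T) : S = T ∧ ∀ c ∈ S, dec c = dec' c := by
  have hcard : S.card = T.card := by
    rw [← size_codeOf dec hS hSc, h, size_codeOf dec' hT hTc]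
  obtain ⟨φ, hφ, hST, hdec⟩ := exists_mapChords_eq hS hSc hT hTc h
  have himage : (endpoints S).image φ = endpoints S := by
    rw [← endpoints_mapChords, hST, hTs, hSs, hcard]
  rw [hSs] at hφ himage
  have hmap : ∀ c ∈ S, Prod.map φ φ c = c := fun c hc => Prod.ext
    (hφ.eq_self_of_image_range himage (hSs ▸ fst_mem_endpoints hc))
    (hφ.eq_self_of_image_range himage (hSs ▸ snd_mem_endpoints hc))
  refine ⟨?_, fun c hc => ?_⟩
  · rw [← hST, mapChords, Finset.image_congr hmap, Finset.image_id']
  · rw [← hdec c hc, hmap c hc]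

/-! ### Fixed point free involutions and diagrams in standard position. -/

section Involutions

variable {n : ℕ} {σ : Equiv.Perm (Fin (2 * n))}

theorem mem_chordsOf {c : Chord} :
    c ∈ chordsOf σ ↔ ∃ i : Fin (2 * n), i < σ i ∧ ((i : ℕ), (σ i : ℕ)) = c := by
  simp only [chordsOf, Finset.mem_image, Finset.mem_filter, Finset.mem_univ, true_and]

theorem isDiagram_chordsOf (hσ : ∀ i, σ (σ i) = i) : IsDiagram (chordsOf σ) := by
  constructor
  · intro c hc
    obtain ⟨i, hi, rfl⟩ := mem_chordsOf.1 hc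
    exact hi
  · intro c hc e he hce
    obtain ⟨i, hi, rfl⟩ := mem_chordsOf.1 hc
    obtain ⟨j, hj, rfl⟩ := mem_chordsOf.1 he
    have hij : i ≠ j := fun hij => hce (hij ▸ rfl)
    refine ⟨fun h => hij (Fin.ext h), fun h => ?_, fun h => ?_,
      fun h => hij (σ.injective (Fin.ext h))⟩
    · have h1 : i = σ j := Fin.ext h
      rw [h1, hσ] at hi
      exact lt_asymm hi hj
    · have h1 : σ i = j := Fin.ext h
      rw [← h1, hσ] at hj
      exact lt_asymm hi hj

theorem endpoints_chordsOf (hσ : ∀ i, σ (σ i) = i) (hfix : ∀ i, σ i ≠ i) :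
    endpoints (chordsOf σ) = Finset.range (2 * n) := by
  ext x
  rw [mem_endpoints, Finset.mem_range]
  constructor
  · rintro ⟨c, hc, h⟩
    obtain ⟨i, hi, rfl⟩ := mem_chordsOf.1 hc
    rcases h with rfl | rfl
    exacts [i.2, (σ i).2]
  · intro hx
    rcases lt_or_gt_of_ne (hfix ⟨x, hx⟩) with h | h
    · exact ⟨_, mem_chordsOf.2 ⟨σ ⟨x, hx⟩, by rwa [hσ], rfl⟩, Or.inr (by rw [hσ])⟩
    · exact ⟨_, mem_chordsOf.2 ⟨⟨x, hx⟩, h, rfl⟩, Or.inl rfl⟩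

theorem card_chordsOf (hσ : ∀ i, σ (σ i) = i) (hfix : ∀ i, σ i ≠ i) :
    (chordsOf σ).card = n := by
  have h := (isDiagram_chordsOf hσ).card_endpoints
  rw [endpoints_chordsOf hσ hfix, Finset.card_range] at h
  omega

theorem isStandard_chordsOf (hσ : ∀ i, σ (σ i) = i) (hfix : ∀ i, σ i ≠ i) :
    IsStandard (chordsOf σ) := by
  rw [IsStandard, endpoints_chordsOf hσ hfix, card_chordsOf hσ hfix]

theorem eq_of_chordsOf_eq {τ : Equiv.Perm (Fin (2 * n))} (hσ : ∀ i, σ (σ i) = i)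
    (hfix : ∀ i, σ i ≠ i) (hτ : ∀ i, τ (τ i) = i) (h : chordsOf σ = chordsOf τ) : σ = τ := by
  have key : ∀ i, i < σ i → τ i = σ i := by
    intro i hi
    have hm : ((i : ℕ), (σ i : ℕ)) ∈ chordsOf τ := h ▸ mem_chordsOf.2 ⟨i, hi, rfl⟩
    obtain ⟨j, -, hj⟩ := mem_chordsOf.1 hm
    rw [Prod.mk.injEq] at hj
    obtain rfl := Fin.ext hj.1
    exact Fin.ext hj.2
  ext1 i
  rcases lt_or_gt_of_ne (hfix i) with hi | hi
  · have h1 := key (σ i) (by rwa [hσ])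
    rw [hσ] at h1
    have h2 := hτ (σ i)
    rw [h1] at h2
    exact h2.symm
  · exact (key i hi).symm

theorem exists_chordsOf_eq {S : Finset Chord} (hS : IsDiagram S) (hSs : IsStandard S) :
    ∃ σ : Equiv.Perm (Fin (2 * S.card)), (∀ i, σ (σ i) = i) ∧ (∀ i, σ i ≠ i) ∧
      chordsOf σ = S := by
  -- The partner of a position is unique; this yields both the involution property and the
  -- identification of its chords with `S`.
  have hfun : ∀ i j k : ℕ, (i, j) ∈ S ∨ (j, i) ∈ S → (i, k) ∈ S ∨ (k, i) ∈ S → j = k := by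
    intro i j k hj hk
    by_contra hne
    rcases hj with hj | hj <;> rcases hk with hk | hk
    · exact (hS.disjoint _ hj _ hk fun h => hne (Prod.mk.inj h).2).1 rfl
    · have h1 := hS.lt _ hj
      refine (hS.disjoint _ hj _ hk fun h => ?_).2.1 rfl
      rw [Prod.mk.injEq] at h
      simp only at h1
      omega
    · have h1 := hS.lt _ hj
      refine (hS.disjoint _ hj _ hk fun h => ?_).2.2.1 rfl
      rw [Prod.mk.injEq] at h
      simp only at h1
      omega
    · exact (hS.disjoint _ hj _ hk fun h => hne (Prod.mk.inj h).1).2.2.2 rfl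
  have hex : ∀ i : Fin (2 * S.card), ∃ j : Fin (2 * S.card),
      ((i : ℕ), (j : ℕ)) ∈ S ∨ ((j : ℕ), (i : ℕ)) ∈ S := by
    intro i
    have hi : (i : ℕ) ∈ endpoints S := by
      rw [hSs, Finset.mem_range]
      exact i.2
    obtain ⟨⟨x, y⟩, hc, h | h⟩ := mem_endpoints.1 hi
    · refine ⟨⟨y, (hSs.lt hc).2⟩, Or.inl ?_⟩
      rwa [← show x = i from h]
    · refine ⟨⟨x, (hSs.lt hc).1⟩, Or.inr ?_⟩
      rwa [← show y = i from h]
  choose f hf using hex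
  have hinv : ∀ i, f (f i) = i := fun i => Fin.ext (hfun (f i) _ _ (hf (f i)) (hf i).symm)
  have hval : ∀ i : Fin (2 * S.card), (Function.Involutive.toPerm f hinv) i = f i := fun _ => rfl
  refine ⟨Function.Involutive.toPerm f hinv, hinv, fun i hi => ?_, ?_⟩
  · rw [hval] at hi
    have h := hf i
    rw [hi] at h
    rcases h with h | h <;> exact lt_irrefl _ (hS.lt _ h)
  · ext ⟨x, y⟩
    rw [mem_chordsOf]
    constructor
    · rintro ⟨i, hi, h⟩
      rw [← h]
      refine (hf i).resolve_right fun h' => ?_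
      exact lt_asymm hi (hS.lt _ h')
    · intro hc
      have hlt := hS.lt _ hc
      have hy : f ⟨x, (hSs.lt hc).1⟩ = ⟨y, (hSs.lt hc).2⟩ :=
        Fin.ext (hfun x _ _ (hf ⟨x, (hSs.lt hc).1⟩) (Or.inl hc))
      refine ⟨⟨x, (hSs.lt hc).1⟩, ?_, ?_⟩
      · rw [hval, hy]
        exact hlt
      · rw [hval, hy]

end Involutions

/-! ### The bijection between decorated diagrams and valid codes. -/

namespace DecChordDiagram

variable {D : Set ℕ+} (C : DecChordDiagram D)

open scoped Classical in
/-- The decorations, extended by `1` to all pairs of positions. -/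
noncomputable def decExt (c : Chord) : ℕ+ :=
  if h : c ∈ chordsOf C.perm then C.dec ⟨c, h⟩ else 1

theorem decExt_coe (c : chordsOf C.perm) : C.decExt c = C.dec c := dif_pos c.2

/-- The code of a decorated diagram. -/
noncomputable def code : ChordCode := codeOf C.decExt C.chords

theorem isDiagram : IsDiagram C.chords := isDiagram_chordsOf C.involutive

theorem isConn : IsConn C.chords := (connected_iff_isConn _).1 C.connected

theorem isStandard : IsStandard C.chords := isStandard_chordsOf C.involutive C.fixedPointFree

theorem isValid_code : C.code.IsValid D := by
  rw [code, isValid_codeOf _ C.isDiagram C.isConn]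
  intro c hc
  exact C.decExt_coe ⟨c, hc⟩ ▸ C.dec_mem _

theorem norm_code : C.code.norm = C.norm := by
  rw [code, norm_codeOf _ C.isDiagram C.isConn, norm, ← Finset.sum_coe_sort]
  exact Finset.sum_congr rfl fun c _ => congrArg _ (C.decExt_coe c)

theorem baseIndex_code : C.code.baseIndex = C.b :=
  (base_codeOf _ C.isDiagram C.isConn).1

theorem baseDec_code : C.code.baseDec = C.dec C.base :=
  (base_codeOf _ C.isDiagram C.isConn).2.trans (C.decExt_coe C.base)

variable {K : Type*} [Field K]

theorem weight_code [CharZero K] (s : K) :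
    C.code.tree.weight (fun d ν => Ring.choose (s * (d : K) + (ν : K) - 2) ν) 0 = C.weight s := by
  rw [code, weight_codeOf _ _ C.isDiagram C.isConn, weight, ← Finset.prod_coe_sort]
  refine Finset.prod_congr rfl fun c _ => ?_
  rw [← C.decExt_coe c]

theorem monomial_code (a : ℕ → ℕ → K) : C.code.monomial a = C.monomialHat a := by
  classical
  rw [code, monomial_codeOf _ _ C.isDiagram C.isConn, monomialHat, Finset.prod_filter,
    Finset.prod_filter, ← Finset.prod_mul_distrib, ← Finset.prod_coe_sort]
  refine Finset.prod_congr rfl fun c _ => ?_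
  rw [monomialFactor, ← C.decExt_coe c]
  have hb : c.1 = baseChord C.chords ↔ c = C.base := ⟨fun h => Subtype.ext h, fun h => h ▸ rfl⟩
  by_cases ht : c.1 ∈ terminalChords C.chords
  · by_cases hcb : c = C.base
    · rw [if_pos ht, if_pos (hb.2 hcb), if_neg fun h => h.2 hcb, if_neg (not_not_intro ht), one_mul]
    · rw [if_pos ht, if_neg fun h => hcb (hb.1 h), if_pos ⟨ht, hcb⟩, if_neg (not_not_intro ht),
        mul_one]
  · rw [if_neg ht, if_neg fun h => ht h.1, if_pos ht, one_mul]

theorem code_injective : Function.Injective (code (D := D)) := by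
  intro C E h
  obtain ⟨h1, h2⟩ := eq_of_codeOf_eq C.isDiagram C.isConn C.isStandard E.isDiagram E.isConn
    E.isStandard h
  have h3 : C.size = E.size := by
    rw [← card_chordsOf C.involutive C.fixedPointFree,
      ← card_chordsOf E.involutive E.fixedPointFree]
    exact congrArg Finset.card h1
  obtain ⟨n, σ, hσ, hσ', hσc, d, hd⟩ := C
  obtain ⟨m, τ, hτ, hτ', hτc, e, he⟩ := E
  obtain rfl : n = m := h3
  obtain rfl : σ = τ := eq_of_chordsOf_eq hσ hσ' hτ h1
  have hde : d = e := by
    funext c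
    have := h2 c.1 c.2
    rwa [decExt_coe, decExt_coe] at this
  subst hde
  rfl

theorem exists_code_eq {c : ChordCode} (hc : c.IsValid D) :
    ∃ C : DecChordDiagram D, C.code = c := by
  obtain ⟨S, dec, hS, hSc, hSs, rfl⟩ := exists_codeOf_eq hc
  rw [isValid_codeOf dec hS hSc] at hc
  obtain ⟨σ, hσ, hσ', hσS⟩ := exists_chordsOf_eq hS hSs
  let C : DecChordDiagram D := ⟨S.card, σ, hσ, hσ', by rw [hσS, connected_iff_isConn]; exact hSc,
    fun c => dec c, fun c => hc c.1 (hσS.subset c.2)⟩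
  refine ⟨C, ?_⟩
  -- Transport along the identity replaces `decExt` by `dec`, which may differ from it outside the
  -- diagram.
  have hid : ∀ T : Finset Chord, mapChords id T = T := fun T => by
    rw [mapChords, Prod.map_id, Finset.image_id]
  have h := codeOf_mapChords (φ := id) C.isDiagram C.isConn strictMono_id (dec := C.decExt)
    (dec' := dec) fun c hc' => (C.decExt_coe ⟨c, hc'⟩).symm
  rw [hid] at h
  rw [code, ← h]
  exact congrArg (codeOf dec) hσS

end DecChordDiagram

/-! ### Transfer from codes to diagrams. -/

section MainTheorem

variable {K : Type*} [Field K] [CharZero K] (D : Set ℕ+) (s : K) (a : ℕ → ℕ → K)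

/-- The contribution `binom(s d + ν - 2, ν)` of a chord to the weight. -/
noncomputable def chordWeight (d ν : ℕ) : K := Ring.choose (s * (d : K) + (ν : K) - 2) ν

/-- Reindexing along the bijection `DecChordDiagram.code`, which preserves norm, base label and each
factor of the summand. -/
theorem coeff_gComb (k i : ℕ) : PowerSeries.coeff i (gComb D s a k) =
    ∑ C ∈ ChordCode.ofNorm D i with k ≤ C.baseIndex, ChordCode.term a (chordWeight s) C k := by
  rw [gComb, PowerSeries.coeff_mk, ← finsum_mem_coe_finset]
  refine finsum_mem_eq_of_bijOn DecChordDiagram.code ⟨fun C hC => ?_,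
    DecChordDiagram.code_injective.injOn, fun c hc => ?_⟩ fun C _ => ?_
  · rw [Finset.mem_coe, Finset.mem_filter, ChordCode.mem_ofNorm, C.norm_code, C.baseIndex_code]
    exact ⟨⟨C.isValid_code, hC.1⟩, hC.2⟩
  · rw [Finset.mem_coe, Finset.mem_filter, ChordCode.mem_ofNorm] at hc
    obtain ⟨C, rfl⟩ := DecChordDiagram.exists_code_eq hc.1.1
    exact ⟨C, ⟨C.norm_code.symm.trans hc.1.2, C.baseIndex_code ▸ hc.2⟩, rfl⟩
  · rw [ChordCode.term, C.monomial_code, C.baseIndex_code, C.baseDec_code]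
    exact congrArg (· * _ * _) (C.weight_code s).symm

theorem gOperator_eq : gOperator D s a = ChordCode.upperSeries D a (chordWeight s) := by
  ext1 l
  rw [gOperator, ChordCode.upperSeries, PowerSeries.coeff_mk, PowerSeries.coeff_mk]
  split_ifs with hl
  · rw [hl, ChordCode.upperSum_zero, mul_zero]
  · congr 1
    ext i
    rw [coeff_gComb, ChordCode.coeff_upperSum_term _ _ hl]

end MainTheorem

theorem mainTheorem6 {K : Type*} [Field K] [CharZero K] (D : Set ℕ+) (s : K) (a : ℕ → ℕ → K) :
    ∃ V : ℕ → D → PowerSeries K,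
      (∀ (n : ℕ) (k : D), HasOperatorValue (gOperator D s a ^ n) (fTilde a ((k : ℕ+) : ℕ)) (V n k)) ∧
      HasFormalSum
        (fun p : D × ℕ => (PowerSeries.X : PowerSeries K) ^ ((p.1 : ℕ+) : ℕ) *
          PowerSeries.C (Ring.choose ((p.2 : K) + s * (((p.1 : ℕ+) : ℕ) : K) - 2) p.2) *
          V p.2 p.1)
        (gComb D s a 1) := by
  refine ⟨fun n k => ChordCode.powerValue D a (chordWeight s) n (k : ℕ+), fun n k => ?_, ?_⟩
  · rw [gOperator_eq]
    exact ChordCode.hasOperatorValue_powerValue a _ n _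
  · have h := ChordCode.hasFormalSum_powerValue (D := D) a (chordWeight s) (S := gComb D s a 1)
      fun i => by
        -- For index 1 the restriction on the base label is void.
        rw [coeff_gComb, Finset.filter_true_of_mem fun C _ => C.baseIndex_pos]
    simp only [chordWeight, add_comm (s * _)] at h
    exact h
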